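/- Let $B$ be a locally Noetherian scheme and $b\in B$ a closed point whose local ring is a discrete valuation ring (for instance a point of a smooth curve, or the closed point of the spectrum of a DVR). Let $\pi:\mathcal X\to B$ be a flat family with $\mathcal X$ locally Noetherian, and let $X_0=\pi^{-1}(b)$ be its scheme-theoretic fiber over $b$, with inclusion $i:X_0\hookrightarrow\mathcal X$. Let $\mathcal Z\subset\mathcal X$ be a reduced closed subscheme no irreducible component of which is contained in $X_0$ (for irreducible $\mathcal Z$: $\mathcal Z\not\subset X_0$). Assume that $\mathcal Z$ is of one of the following two types: (a) $\mathcal Z$ is locally a complete intersection in $\mathcal X$, i.e. near each of its points its ideal is generated by a regular sequence (for instance, $\mathcal Z$ is a smooth center in a smooth $\mathcal X$, or a reduced proper intersection of Cartier divisors in a smooth $\mathcal X$); (b) $\mathcal X$ is a double cover $p:\mathcal X\to\mathcal V$ of a scheme $\mathcal V$, branched along an effective Cartier divisor $\mathcal B\subset\mathcal V$ (locally on $\mathcal V$ the cover is $w^2=F$, with $F$ a local equation of $\mathcal B$ and $2$ invertible), and $\mathcal Z$ is the reduced preimage of a reduced closed subscheme $\mathcal W\subset\mathcal V$ that is locally a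 complete intersection in $\mathcal V$ and along which $\mathcal B$ has multiplicity at least two, in the sense that $F\in I_{\mathcal W}^2$. Let $\sigma:\widetilde{\mathcal X}\to\mathcal X$ be the blow-up of $\mathcal X$ along $\mathcal Z$, with exceptional divisor $\mathcal E=\sigma^{-1}(\mathcal Z)$. Let $\sigma^{-1}(X_0)=\widetilde{\mathcal X}\times_{\mathcal X}X_0$, and let $\sigma_0=\sigma|_{X_0}:\sigma^{-1}(X_0)\to X_0$ be the restriction of $\sigma$. Then: 1. $\sigma_0$ is the blow-up of $X_0$ along the scheme-theoretic intersection $\mathcal Z\cap X_0$. Its exceptional divisor $E$ is the restriction $\mathcal E|_{\sigma^{-1}(X_0)}$, both as a closed subscheme and as a Cartier divisor. 2. Suppose that $X_0$ is reduced. Let $\mathcal D$ be a Cartier divisor on $\mathcal X$ (not necessarily effective) such that no irreducible component of its support is contained in $X_0$, and let $k\in\mathbb Z$. Then the Cartier divisors $\sigma^*\mathcal D$, $\mathcal D|_{X_0}=i^*\mathcal D$ and $\sigma_0^*(\mathcal D|_{X_0})$ are defined, the divisor $\mathcal D^*:=\sigma^*\mathcal D-k\mathcal E$ can be restricted to $\sigma^{-1}(X_0)$,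 and, as Cartier divisors on $\sigma^{-1}(X_0)$, $$\mathcal D^*|_{\sigma^{-1}(X_0)}=\sigma_0^*(\mathcal D|_{X_0})-kE .$$ -/

import Mathlib

open CategoryTheory CategoryTheory.Limits AlgebraicGeometry

universe u

namespace FamilyBlowUp

variable {X Y : Scheme.{u}}

/-! ### Effective Cartier divisors and blow-ups -/

/-- The closed subscheme cut out by the ideal sheaf `I` is an effective Cartier divisor: around
every point there is an affine open on which `I` is generated by one non-zero-divisor. -/
def IsEffectiveCartier (I : X.IdealSheafData) : Prop :=
  ∀ x : X, ∃ U : X.affineOpens, x ∈ U.1 ∧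
    ∃ f ∈ nonZeroDivisors Γ(X, U.1), I.ideal U = Ideal.span {f}

/-- `σ : X' ⟶ X` is the blow-up of `X` along the closed subscheme with ideal sheaf `Z`: the scheme
theoretic preimage of the center is an effective Cartier divisor, and `σ` is universal with this
property. -/
structure IsBlowUp {X' X : Scheme.{u}} (σ : X' ⟶ X) (Z : X.IdealSheafData) : Prop where
  isEffectiveCartier : IsEffectiveCartier (Z.comap σ)
  existsUnique_lift : ∀ {W : Scheme.{u}} (f : W ⟶ X), IsEffectiveCartier (Z.comap f) →
    ∃! g : W ⟶ X', g ≫ σ = f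

/-! ### Cartier divisors

A Cartier divisor is a global section of the sheaf of invertible meromorphic functions modulo
invertible functions. It is recorded by its germs, which lie in `Frac(𝒪ₓ)ˣ / 𝒪ₓˣ` and are locally
the germs of one quotient `f / g` of regular (nowhere zero-dividing) sections. -/

/-- The group `Frac(𝒪ₓ)ˣ / 𝒪ₓˣ`, written additively. -/
def DivisorGerm (X : Scheme.{u}) (x : X) : Type u :=
  Additive ((FractionRing (X.presheaf.stalk x))ˣ ⧸
    (Units.map (algebraMap (X.presheaf.stalk x)
      (FractionRing (X.presheaf.stalk x))).toMonoidHom).range)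

noncomputable instance (X : Scheme.{u}) (x : X) : AddCommGroup (DivisorGerm X x) :=
  inferInstanceAs (AddCommGroup (Additive ((FractionRing (X.presheaf.stalk x))ˣ ⧸
    (Units.map (algebraMap (X.presheaf.stalk x)
      (FractionRing (X.presheaf.stalk x))).toMonoidHom).range)))

/-- The germ of the divisor of a non-zero-divisor `a` of the local ring at `x`. -/
noncomputable def divGerm {x : X} (a : nonZeroDivisors (X.presheaf.stalk x)) : DivisorGerm X x :=
  Additive.ofMul (QuotientGroup.mk
    (IsLocalization.map_units (FractionRing (X.presheaf.stalk x)) a).unit)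

lemma divGerm_mul {x : X} (a b : nonZeroDivisors (X.presheaf.stalk x)) :
    divGerm (a * b) = divGerm a + divGerm b := by
  refine Eq.trans ?_ (ofMul_mul _ _)
  rw [divGerm, ← QuotientGroup.mk_mul]
  congr 2
  ext
  simp

lemma divGerm_eq_of_associated {x : X} (a b : nonZeroDivisors (X.presheaf.stalk x))
    (c : (X.presheaf.stalk x)ˣ) (h : (a : X.presheaf.stalk x) * c = b) :
    divGerm a = divGerm b := by
  rw [divGerm, divGerm]
  congr 1
  rw [QuotientGroup.eq]
  refine ⟨c, ?_⟩
  rw [eq_inv_mul_iff_mul_eq]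
  ext
  simp [← h]

/-- `D` is the divisor of `f / g` on the open set `U`, where `f` and `g` are sections over `U`
whose germs are non-zero-divisors. -/
def IsLocallyDivOf (D : ∀ x : X, DivisorGerm X x) (U : X.Opens) (f g : Γ(X, U)) : Prop :=
  ∀ (y : X) (hy : y ∈ U),
    ∃ (hf : X.presheaf.germ U y hy f ∈ nonZeroDivisors (X.presheaf.stalk y))
      (hg : X.presheaf.germ U y hy g ∈ nonZeroDivisors (X.presheaf.stalk y)),
      D y = divGerm ⟨_, hf⟩ - divGerm ⟨_, hg⟩

/-- The group of Cartier divisors of a scheme. -/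
def CartierDivisor (X : Scheme.{u}) : AddSubgroup (∀ x : X, DivisorGerm X x) where
  carrier := {D | ∀ x : X, ∃ U : X.Opens, x ∈ U ∧ ∃ f g : Γ(X, U), IsLocallyDivOf D U f g}
  zero_mem' := fun x => ⟨⊤, trivial, 1, 1, fun y hy => by
    have h : X.presheaf.germ ⊤ y hy 1 ∈ nonZeroDivisors (X.presheaf.stalk y) := by
      rw [map_one]; exact one_mem _
    exact ⟨h, h, by simp⟩⟩
  add_mem' := by
    intro D E hD hE x
    obtain ⟨U, hxU, f, g, hfg⟩ := hD x
    obtain ⟨V, hxV, f', g', hfg'⟩ := hE x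
    refine ⟨U ⊓ V, ⟨hxU, hxV⟩,
      X.presheaf.map (homOfLE inf_le_left).op f * X.presheaf.map (homOfLE inf_le_right).op f',
      X.presheaf.map (homOfLE inf_le_left).op g * X.presheaf.map (homOfLE inf_le_right).op g',
      fun y hy => ?_⟩
    obtain ⟨hf, hg, e⟩ := hfg y hy.1
    obtain ⟨hf', hg', e'⟩ := hfg' y hy.2
    have key : ∀ (s : Γ(X, U)) (s' : Γ(X, V)), X.presheaf.germ (U ⊓ V) y hy
        (X.presheaf.map (homOfLE inf_le_left).op s * X.presheaf.map (homOfLE inf_le_right).op s') =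
        X.presheaf.germ U y hy.1 s * X.presheaf.germ V y hy.2 s' := by
      intro s s'
      rw [map_mul, TopCat.Presheaf.germ_res_apply, TopCat.Presheaf.germ_res_apply]
    refine ⟨by rw [key]; exact mul_mem hf hf', by rw [key]; exact mul_mem hg hg', ?_⟩
    have e1 := divGerm_mul ⟨_, hf⟩ ⟨_, hf'⟩
    have e2 := divGerm_mul ⟨_, hg⟩ ⟨_, hg'⟩
    simp only [key]
    rw [Pi.add_apply, e, e']
    change _ = divGerm (⟨_, hf⟩ * ⟨_, hf'⟩) - divGerm (⟨_, hg⟩ * ⟨_, hg'⟩)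
    rw [e1, e2]
    abel
  neg_mem' := by
    intro D hD x
    obtain ⟨U, hxU, f, g, hfg⟩ := hD x
    refine ⟨U, hxU, g, f, fun y hy => ?_⟩
    obtain ⟨hf, hg, e⟩ := hfg y hy
    exact ⟨hg, hf, by rw [Pi.neg_apply, e, neg_sub]⟩

/-- The support of a Cartier divisor: the points at which it has no unit as a local equation. -/
def CartierDivisor.support (D : CartierDivisor X) : Set X := {x | D.1 x ≠ 0}

/-- `IsPullbackOf f D D'`: the pullback of the Cartier divisor `D` under `f` is defined and equals
`D'`. That is, near each point `D` has a local equation `a / b` with `a` and `b` staying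
non-zero-divisors after pullback, and `D'` has the local equation `f^* a / f^* b`.
For an inclusion of a closed subscheme this is the restriction of `D`. -/
def CartierDivisor.IsPullbackOf (f : X ⟶ Y) (D : CartierDivisor Y) (D' : CartierDivisor X) :
    Prop :=
  ∀ x : X, ∃ (a b : nonZeroDivisors (Y.presheaf.stalk (f x)))
    (ha : (f.stalkMap x).hom a ∈ nonZeroDivisors (X.presheaf.stalk x))
    (hb : (f.stalkMap x).hom b ∈ nonZeroDivisors (X.presheaf.stalk x)),
    D.1 (f x) = divGerm a - divGerm b ∧ D'.1 x = divGerm ⟨_, ha⟩ - divGerm ⟨_, hb⟩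

lemma germ_mem_nonZeroDivisors (U : X.affineOpens) (f : Γ(X, U.1))
    (hf : f ∈ nonZeroDivisors Γ(X, U.1)) (x : X) (hx : x ∈ U.1) :
    X.presheaf.germ U.1 x hx f ∈ nonZeroDivisors (X.presheaf.stalk x) := by
  let _ := TopCat.Presheaf.algebra_section_stalk X.presheaf (⟨x, hx⟩ : U.1)
  have := U.2.isLocalization_stalk ⟨x, hx⟩
  exact IsLocalization.map_nonZeroDivisors_le
    (U.2.primeIdealOf ⟨x, hx⟩).asIdeal.primeCompl (X.presheaf.stalk x) ⟨f, hf, rfl⟩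

lemma divGerm_eq_of_span_eq (I : X.IdealSheafData) (U V : X.affineOpens)
    (f : Γ(X, U.1)) (g : Γ(X, V.1)) (hf : I.ideal U = Ideal.span {f})
    (hg : I.ideal V = Ideal.span {g}) (x : X) (hxU : x ∈ U.1) (hxV : x ∈ V.1)
    (hfx : X.presheaf.germ U.1 x hxU f ∈ nonZeroDivisors (X.presheaf.stalk x))
    (hgx : X.presheaf.germ V.1 x hxV g ∈ nonZeroDivisors (X.presheaf.stalk x)) :
    divGerm ⟨_, hfx⟩ = divGerm ⟨_, hgx⟩ := by
  obtain ⟨W, hW, hxW, hWle⟩ := X.isBasis_affineOpens.exists_subset_of_mem_open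
    (show x ∈ U.1 ⊓ V.1 from ⟨hxU, hxV⟩) (U.1 ⊓ V.1).2
  obtain ⟨W, hWaff, rfl⟩ := hW
  have hU : (⟨W, hWaff⟩ : X.affineOpens) ≤ U := fun y hy => (hWle hy).1
  have hV : (⟨W, hWaff⟩ : X.affineOpens) ≤ V := fun y hy => (hWle hy).2
  have h := (I.map_ideal hU).trans (I.map_ideal hV).symm
  rw [hf, hg, Ideal.map_span, Ideal.map_span, Set.image_singleton, Set.image_singleton] at h
  have h2 := congrArg (Ideal.map (X.presheaf.germ W x hxW).hom) h
  rw [Ideal.map_span, Ideal.map_span, Set.image_singleton, Set.image_singleton] at h2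
  erw [TopCat.Presheaf.germ_res_apply, TopCat.Presheaf.germ_res_apply] at h2
  obtain ⟨c, hc⟩ := Ideal.mem_span_singleton'.1 (h2.symm.le (Ideal.mem_span_singleton_self _))
  obtain ⟨d, hd⟩ := Ideal.mem_span_singleton'.1 (h2.le (Ideal.mem_span_singleton_self _))
  have hcd : d * c = 1 := by
    refine (mul_cancel_right_mem_nonZeroDivisors hfx).1 ?_
    rw [mul_assoc, hc, one_mul]
    exact hd
  exact divGerm_eq_of_associated _ _ ⟨c, d, by rw [mul_comm, hcd], hcd⟩
    ((mul_comm _ _).trans hc)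

/-- An effective Cartier divisor, given by its ideal sheaf, as an element of the group of Cartier
divisors: its local equations are the local generators of the ideal sheaf. -/
noncomputable def IsEffectiveCartier.toCartierDivisor {I : X.IdealSheafData}
    (hI : IsEffectiveCartier I) : CartierDivisor X :=
  ⟨fun x => divGerm ⟨X.presheaf.germ (hI x).choose.1 x (hI x).choose_spec.1
      (hI x).choose_spec.2.choose,
    germ_mem_nonZeroDivisors _ _ (hI x).choose_spec.2.choose_spec.1 _ _⟩, by
    intro x
    refine ⟨(hI x).choose.1, (hI x).choose_spec.1, (hI x).choose_spec.2.choose, 1,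
      fun y hy => ?_⟩
    have h1 : X.presheaf.germ (hI x).choose.1 y hy 1 ∈ nonZeroDivisors (X.presheaf.stalk y) := by
      rw [map_one]; exact one_mem _
    refine ⟨germ_mem_nonZeroDivisors _ _ (hI x).choose_spec.2.choose_spec.1 _ _, h1, ?_⟩
    have h2 : divGerm (⟨_, h1⟩ : nonZeroDivisors (X.presheaf.stalk y)) = 0 := by
      have := divGerm_mul (1 : nonZeroDivisors (X.presheaf.stalk y)) 1
      rw [mul_one, left_eq_add] at this
      rw [← this]
      congr 1
      exact Subtype.ext (map_one _)
    rw [h2, sub_zero]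
    exact divGerm_eq_of_span_eq I _ _ _ _ (hI y).choose_spec.2.choose_spec.2
      (hI x).choose_spec.2.choose_spec.2 y _ _ _ _⟩

/-- The exceptional divisor of a blow-up, the preimage of the center, as a Cartier divisor. -/
noncomputable def IsBlowUp.exceptionalDivisor {X' X : Scheme.{u}} {σ : X' ⟶ X}
    {Z : X.IdealSheafData} (h : IsBlowUp σ Z) : CartierDivisor X' :=
  h.isEffectiveCartier.toCartierDivisor

/-- No irreducible component of the subset `S` is contained in `T`. -/
def HasNoComponentIn {α : Type*} [TopologicalSpace α] (S T : Set α) : Prop :=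
  ∀ C ∈ irreducibleComponents S, ¬ (Subtype.val '' C ⊆ T)

/-! ### Centers -/

/-- The closed subscheme with ideal sheaf `Z` is regularly immersed (a local complete
intersection in `X`): near each of its points its ideal is generated by a regular sequence. -/
def IsRegularlyImmersed (Z : X.IdealSheafData) : Prop :=
  ∀ x ∈ Z.support, ∃ U : X.affineOpens, x ∈ U.1 ∧ ∃ rs : List Γ(X, U.1),
    RingTheory.Sequence.IsRegular Γ(X, U.1) rs ∧ Z.ideal U = Ideal.ofList rs

/-- `p : X ⟶ V` is a double cover branched along the effective Cartier divisor with ideal sheaf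
`D`: locally on `V` it is given by the equation `w ^ 2 = F`, where `F` is a local equation of `D`
and `2` is invertible. -/
structure IsDoubleCover {X V : Scheme.{u}} (p : X ⟶ V) (D : V.IdealSheafData) : Prop where
  isAffineHom : IsAffineHom p
  local_eq : ∀ v : V, ∃ U : V.affineOpens, v ∈ U.1 ∧ IsUnit (2 : Γ(V, U.1)) ∧
    ∃ F ∈ nonZeroDivisors Γ(V, U.1), D.ideal U = Ideal.span {F} ∧
      ∃ w : Γ(X, p ⁻¹ᵁ U.1), w ^ 2 = p.app U.1 F ∧
        ∀ g : Γ(X, p ⁻¹ᵁ U.1), ∃! c : Γ(V, U.1) × Γ(V, U.1),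
          g = p.app U.1 c.1 + p.app U.1 c.2 * w

/-- `Z` is the reduced preimage, in a double cover `X` of some scheme `V`, of a reduced regularly
immersed closed subscheme `W` of `V` along which the branch divisor `D` has multiplicity at
least two. -/
def IsDoubleCoverCenter (Z : X.IdealSheafData) : Prop :=
  ∃ (V : Scheme.{u}) (p : X ⟶ V) (D W : V.IdealSheafData),
    IsDoubleCover p D ∧ AlgebraicGeometry.IsReduced W.subscheme ∧ IsRegularlyImmersed W ∧
      D ≤ W ^ 2 ∧ Z = (W.comap p).radical

end FamilyBlowUp

open FamilyBlowUp

/-! By flatness, a uniformizer at `b` pulls back to a non-zero-divisor `t` that locally cuts out the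
fiber, so everything becomes a question about multiplication by `t`. The base change of `σ` to the
fiber inherits the universal property of a blow-up as soon as the preimage of the center in it is
Cartier (`IsBlowUp.pullback_snd`), that is, as soon as a local equation of the exceptional divisor
is a non-zero-divisor modulo `t`. With `I` the ideal of the center, clearing denominators in a chart
`O[I / a]` reduces this to `t` being a non-zero-divisor modulo every power `I ^ n`
(`IsBlowUpChart.mem_span_of_mul_mem`).

For `n = 1` this holds because the center is reduced and has no component in the fiber. The passage
to all `n` rests on the torsion-freeness of `I ^ m / I ^ (m + 1)` over `A / I` (`IsNormallyFlat`),
the only place where the type of the center matters. A regular sequence is treated by adding one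
generator at a time (`IsNormallyFlat.sup_span`). In a double cover the ideal is `J A + (w)`; since
`F ∈ J ^ 2`, its powers are `J ^ (m + 1) ⊕ J ^ m w`, and the claim is read off from the two
coordinates (`IsNormallyFlat.map_sup_span`).

The blow-up is known only by its universal property; `IsBlowUp.exists_isBlowUpChart` extracts its
local rings from it. The same description shows that blow-ups preserve non-zero-divisors, so Cartier
divisors pull back along `σ` and `σ₀`.

To restrict `D` to a reduced fiber, prime avoidance rewrites its equation as a quotient of elements
outside the minimal primes of `(t)`. This needs `D` to be trivial at the generic points of the
fiber: by Nakayama, primes strictly below these contain no non-zero-divisor, so a generic point in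
the support would span a component of the support inside the fiber. The final formula is
functoriality of pullback around the fiber square. -/

namespace FamilyBlowUp

/-! ### Normal flatness of ideals generated by regular sequences -/

section Algebra

variable {A : Type*} [CommRing A]

/-- A torsion-freeness form of the flatness of `⨁ Iᵐ / Iᵐ⁺¹` over `A ⧸ I`: an element which is a
non-zero-divisor modulo an ideal `K` containing `I` is a non-zero-divisor on `Iᵐ / K Iᵐ`. -/
def IsNormallyFlat (I : Ideal A) : Prop :=
  ∀ K : Ideal A, I ≤ K → ∀ s : A, (∀ y, s * y ∈ K → y ∈ K) →
    ∀ m : ℕ, ∀ y ∈ I ^ m, s * y ∈ K * I ^ m → y ∈ K * I ^ m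

lemma isNormallyFlat_top : IsNormallyFlat (⊤ : Ideal A) := by
  intro K hK s _ m y _ _
  obtain rfl := top_le_iff.1 hK
  simp [Ideal.top_pow]

lemma isNormallyFlat_bot : IsNormallyFlat (⊥ : Ideal A) := by
  intro K _ s hs m y hy hsy
  rcases m with - | m
  · rw [pow_zero, Ideal.one_eq_top, Ideal.mul_top] at hsy ⊢
    exact hs y hsy
  · rw [pow_succ, Ideal.mul_bot, Ideal.mem_bot] at hy
    rw [hy]
    exact zero_mem _

/-- Normal flatness with `K = I` climbs one power at a time. -/
lemma IsNormallyFlat.mem_pow {I : Ideal A} (hI : IsNormallyFlat I) {s : A}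
    (hs : ∀ y, s * y ∈ I → y ∈ I) (n : ℕ) : ∀ y, s * y ∈ I ^ n → y ∈ I ^ n := by
  induction n with
  | zero => simp
  | succ n ih =>
    intro y hy
    rw [pow_succ'] at hy ⊢
    exact hI I le_rfl s hs n y (ih y (Ideal.mul_le_right (I := I) (J := I ^ n) hy)) hy

lemma exists_add_mul_of_mem_sup_span_mul {K L L' : Ideal A} {x y : A}
    (h : y ∈ K * (L ⊔ Ideal.span {x} * L')) :
    ∃ j ∈ K * L, ∃ z ∈ K * L', y = j + x * z := by
  rw [Ideal.mul_sup, mul_left_comm, Submodule.mem_sup] at h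
  obtain ⟨j, hj, k, hk, rfl⟩ := h
  obtain ⟨z, hz, rfl⟩ := Ideal.mem_span_singleton_mul.1 hk
  exact ⟨j, hj, z, hz, rfl⟩

lemma sup_span_pow_succ (J : Ideal A) (x : A) (m : ℕ) :
    (J ⊔ Ideal.span {x}) ^ (m + 1) =
      J ^ (m + 1) ⊔ Ideal.span {x} * (J ⊔ Ideal.span {x}) ^ m := by
  induction m with
  | zero => simp
  | succ m ih =>
    apply le_antisymm
    · conv_lhs => rw [pow_succ', Ideal.sup_mul]
      refine sup_le ?_ le_sup_right
      conv_lhs => rw [ih, Ideal.mul_sup, ← pow_succ']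
      refine sup_le le_sup_left (le_sup_of_le_right ?_)
      rw [mul_left_comm]
      refine Ideal.mul_mono_right ?_
      rw [pow_succ' _ m]
      exact Ideal.mul_mono_left (le_sup_left (b := Ideal.span {x}))
    · refine sup_le (Ideal.pow_right_mono (le_sup_left (b := Ideal.span {x})) _) ?_
      rw [pow_succ' _ (m + 1)]
      exact Ideal.mul_mono_left (le_sup_right (a := J))

/-- Write `y = j + x y'` and `s y = j' + x w` along `I ^ (m + 1) = J ^ (m + 1) + x I ^ m`. The two
parts are compared modulo `J ^ (m + 1)`, where `x` can be cancelled: `y'` is handled by induction on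
`m` and `j` by normal flatness of `J`. The latter is applied to a `K` larger than `J`, which is why
the definition lets `K` vary. -/
lemma IsNormallyFlat.sup_span {J : Ideal A} (hJ : IsNormallyFlat J) {x : A}
    (hx : ∀ y, x * y ∈ J → y ∈ J) : IsNormallyFlat (J ⊔ Ideal.span {x}) := by
  intro K hK s hs m
  set I := J ⊔ Ideal.span {x} with hI
  have hJI : J ≤ I := le_sup_left
  have hxI : x ∈ I := le_sup_right (a := J) (Ideal.mem_span_singleton_self x)
  induction m with
  | zero => intro y _ hy; simpa using hs y (by simpa using hy)
  | succ m ih =>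
    intro y hy hsy
    obtain ⟨j, hj, y', hy', rfl⟩ := exists_add_mul_of_mem_sup_span_mul (K := ⊤) (x := x)
      (L := J ^ (m + 1)) (L' := I ^ m) (y := y)
      (by rwa [Ideal.top_mul, hI, ← sup_span_pow_succ])
    rw [Ideal.top_mul] at hj hy'
    rw [hI, sup_span_pow_succ, ← hI] at hsy
    obtain ⟨j', hj', w, hw, e⟩ := exists_add_mul_of_mem_sup_span_mul hsy
    -- Since `x (w - s y') = s j - j'` lies in `J ^ (m + 1)`, the factor `x` can be cancelled.
    have h1 : w - s * y' ∈ J ^ (m + 1) := by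
      refine hJ.mem_pow hx (m + 1) _ ?_
      have : x * (w - s * y') = s * j - j' := by linear_combination -e
      rw [this]
      exact sub_mem (Ideal.mul_mem_left _ _ hj) (Ideal.mul_le_right hj')
    have h2 : y' ∈ K * I ^ m := by
      refine ih y' hy' ?_
      have h3 : w - s * y' ∈ K * I ^ m := by
        rw [pow_succ'] at h1
        exact Ideal.mul_mono (hJI.trans hK) (Ideal.pow_right_mono hJI _) h1
      have := sub_mem hw h3
      rwa [sub_sub_cancel] at this
    -- The error term `x (w - s y')` lies in `K J ^ (m + 1)` because `x ∈ K`.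
    have h4 : j ∈ K * J ^ (m + 1) := by
      refine hJ K (hJI.trans hK) s hs _ j hj ?_
      have : s * j = j' + x * (w - s * y') := by linear_combination e
      rw [this]
      exact add_mem hj' (Ideal.mul_mem_mul (hK hxI) h1)
    refine add_mem (Ideal.mul_mono_right (Ideal.pow_right_mono hJI _) h4) ?_
    rw [pow_succ', mul_left_comm]
    exact Ideal.mul_mem_mul hxI h2

open RingTheory.Sequence in
-- The induction removes the last element, which is regular modulo the ideal of the preceding ones.
lemma isNormallyFlat_ofList (rs : List A) (h : IsWeaklyRegular A rs) :
    IsNormallyFlat (Ideal.ofList rs) := by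
  induction rs using List.reverseRecOn with
  | nil => simpa using isNormallyFlat_bot
  | append_singleton rs x ih =>
    rw [isWeaklyRegular_append_iff] at h
    rw [Ideal.ofList_append, Ideal.ofList_singleton]
    refine (ih h.1).sup_span fun y hy => ?_
    have h2 := (isWeaklyRegular_singleton_iff _ _).1 h.2
    have h3 := h2 (a₁ := Submodule.Quotient.mk y) (a₂ := 0) (by
      simp only [smul_zero]
      rw [← Submodule.Quotient.mk_smul, Submodule.Quotient.mk_eq_zero]
      simpa using hy)
    rw [Submodule.Quotient.mk_eq_zero] at h3
    simpa using h3

/-! ### Normal flatness and localization -/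

section Localization

variable {B : Type*} [CommRing B] [Algebra A B]

lemma exists_mul_mem_of_algebraMap_mem_map (M : Submonoid A)
    [IsLocalization M B] {I : Ideal A} {y : A}
    (h : algebraMap A B y ∈ I.map (algebraMap A B)) : ∃ v ∈ M, v * y ∈ I := by
  obtain ⟨v, hv, h⟩ := (IsLocalization.algebraMap_mem_map_algebraMap_iff M B I y).1 h
  exact ⟨v, hv, h⟩

lemma mem_map_of_mul_mem (M : Submonoid A)
    [IsLocalization M B] {I : Ideal A} {v y : A} (hv : v ∈ M) (h : v * y ∈ I) :
    algebraMap A B y ∈ I.map (algebraMap A B) :=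
  (IsLocalization.algebraMap_mem_map_algebraMap_iff M B I y).2 ⟨v, hv, h⟩

lemma IsNormallyFlat.map_isLocalization (M : Submonoid A)
    [IsLocalization M B] {I : Ideal A} (hI : IsNormallyFlat I) :
    IsNormallyFlat (I.map (algebraMap A B)) := by
  intro K' hK' s' hs' m y hy hsy
  obtain ⟨⟨s, u⟩, hsu⟩ := IsLocalization.surj M s'
  obtain ⟨⟨y₀, v⟩, hyv⟩ := IsLocalization.surj M y
  simp only at hsu hyv
  have hu := IsLocalization.map_units B u
  have hv := IsLocalization.map_units B v
  set K := K'.comap (algebraMap A B) with hKdef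
  have hKmap : K.map (algebraMap A B) = K' := IsLocalization.map_under M B K'
  have hIK : I ≤ K := Ideal.map_le_iff_le_comap.1 hK'
  have hs : ∀ y, s * y ∈ K → y ∈ K := by
    intro y hy
    refine hs' _ ?_
    rw [hKdef, Ideal.mem_comap, map_mul, ← hsu, mul_right_comm] at hy
    exact (Ideal.mul_unit_mem_iff_mem _ hu).1 hy
  rw [← Ideal.map_pow] at hy
  rw [← hKmap, ← Ideal.map_pow, ← Ideal.map_mul] at hsy ⊢
  have h1 : algebraMap A B y₀ ∈ (I ^ m).map (algebraMap A B) := by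
    rw [← hyv]; exact Ideal.mul_mem_right _ _ hy
  have h2 : algebraMap A B (s * y₀) ∈ (K * I ^ m).map (algebraMap A B) := by
    rw [map_mul, ← hsu, ← hyv]
    have := Ideal.mul_mem_right (algebraMap A B u * algebraMap A B v) _ hsy
    convert this using 1
    ring
  obtain ⟨v₁, hv₁, h1⟩ := exists_mul_mem_of_algebraMap_mem_map M h1
  obtain ⟨v₂, hv₂, h2⟩ := exists_mul_mem_of_algebraMap_mem_map M h2
  have h3 : v₂ * v₁ * y₀ ∈ K * I ^ m := by
    refine hI K hIK s hs m _ ?_ ?_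
    · rw [mul_assoc]; exact Ideal.mul_mem_left _ _ h1
    · have := Ideal.mul_mem_left _ v₁ h2
      convert this using 1
      ring
  refine (Ideal.mul_unit_mem_iff_mem _ hv).1 ?_
  rw [hyv]
  exact mem_map_of_mul_mem M (mul_mem hv₂ hv₁) h3

end Localization

/-- A failure of membership makes a colon ideal proper, hence contained in some maximal `P`;
localizing at `P` produces an element of that colon ideal outside `P`. -/
lemma isNormallyFlat_of_forall_isMaximal {A : Type u} [CommRing A] {I : Ideal A}
    (h : ∀ (P : Ideal A) [P.IsMaximal], ∃ (B : Type u) (_ : CommRing B) (_ : Algebra A B)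
      (_ : IsLocalization.AtPrime B P), IsNormallyFlat (I.map (algebraMap A B))) :
    IsNormallyFlat I := by
  intro K hK s hs m y hy hsy
  by_contra hcon
  let 𝔞 : Ideal A := (K * I ^ m).colon {y}
  have h𝔞 : 𝔞 ≠ ⊤ := by
    intro h
    have : (1 : A) ∈ 𝔞 := h ▸ trivial
    rw [Submodule.mem_colon_singleton] at this
    exact hcon (by simpa using this)
  obtain ⟨P, hP, hle⟩ := Ideal.exists_le_maximal 𝔞 h𝔞
  obtain ⟨B, _, _, _, hB⟩ := h P
  have h1 := hB (K.map (algebraMap A B)) (Ideal.map_mono hK) (algebraMap A B s) (by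
    intro z hz
    obtain ⟨⟨z₀, v⟩, hzv⟩ := IsLocalization.surj P.primeCompl z
    have hv := IsLocalization.map_units B v
    refine (Ideal.mul_unit_mem_iff_mem _ hv).1 ?_
    have h2 := Ideal.mul_mem_right (algebraMap A B v) _ hz
    simp only at hzv
    rw [mul_assoc, hzv, ← map_mul] at h2
    obtain ⟨w, hw, h2⟩ := exists_mul_mem_of_algebraMap_mem_map P.primeCompl h2
    rw [hzv]
    refine mem_map_of_mul_mem P.primeCompl hw (hs _ ?_)
    rwa [mul_left_comm])
    m (algebraMap A B y) (by
      rw [← Ideal.map_pow]; exact Ideal.mem_map_of_mem _ hy) (by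
      rw [← Ideal.map_pow, ← Ideal.map_mul, ← map_mul]; exact Ideal.mem_map_of_mem _ hsy)
  rw [← Ideal.map_pow, ← Ideal.map_mul] at h1
  obtain ⟨v, hv, h1⟩ := exists_mul_mem_of_algebraMap_mem_map P.primeCompl h1
  exact hv (hle (Submodule.mem_colon_singleton.2 h1))

end Algebra

end FamilyBlowUp

namespace FamilyBlowUp

/-! ### Centers in a double cover `w ^ 2 = F` -/

section QuadraticAlgebra

variable {C A : Type*} [CommRing C] [CommRing A] (φ : C →+* A) (w : A) (F : C)

/-- The ideal of all `φ a + φ b * w` with `a ∈ L` and `b ∈ L'`, where `w ^ 2 = φ F`. -/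
def twistedIdeal (hw : w ^ 2 = φ F) (hgen : ∀ g : A, ∃ c : C × C, g = φ c.1 + φ c.2 * w)
    (L L' : Ideal C) (h : L ≤ L') (h' : Ideal.span {F} * L' ≤ L) : Ideal A where
  carrier := {g | ∃ a ∈ L, ∃ b ∈ L', g = φ a + φ b * w}
  zero_mem' := ⟨0, zero_mem _, 0, zero_mem _, by simp⟩
  add_mem' := by
    rintro _ _ ⟨a, ha, b, hb, rfl⟩ ⟨a', ha', b', hb', rfl⟩
    exact ⟨a + a', add_mem ha ha', b + b', add_mem hb hb', by simp only [map_add]; ring⟩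
  smul_mem' := by
    rintro g _ ⟨a, ha, b, hb, rfl⟩
    obtain ⟨⟨c, d⟩, rfl⟩ := hgen g
    refine ⟨c * a + d * (F * b), add_mem (Ideal.mul_mem_left _ _ ha) (Ideal.mul_mem_left _ _
      (h' (Ideal.mul_mem_mul (Ideal.mem_span_singleton_self F) hb))), d * a + c * b,
      add_mem (Ideal.mul_mem_left _ _ (h ha)) (Ideal.mul_mem_left _ _ hb), ?_⟩
    simp only [map_add, map_mul, smul_eq_mul, ← hw]
    ring

variable {φ w F} (hw : w ^ 2 = φ F) (huniq : ∀ g : A, ∃! c : C × C, g = φ c.1 + φ c.2 * w)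
  {J : Ideal C} (hF : F ∈ J ^ 2)

include huniq in
lemma mem_twistedIdeal_iff {L L' : Ideal C} (h : L ≤ L') (h' : Ideal.span {F} * L' ≤ L) (a b : C) :
    φ a + φ b * w ∈ twistedIdeal φ w F hw (fun g => (huniq g).exists) L L' h h' ↔
      a ∈ L ∧ b ∈ L' := by
  constructor
  · rintro ⟨a', ha', b', hb', e⟩
    have := (huniq (φ a + φ b * w)).unique (y₁ := (a, b)) (y₂ := (a', b')) rfl e
    simp only [Prod.mk.injEq] at this
    rw [this.1, this.2]
    exact ⟨ha', hb'⟩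
  · rintro ⟨ha, hb⟩
    exact ⟨a, ha, b, hb, rfl⟩

include huniq hw in
-- The four inclusions bound the terms of `(a + b w)(a' + b' w) = (a a' + F b b') + (a b' + b a')
-- w`.
lemma mul_le_twistedIdeal {L L' L₁ L₁' L₂ L₂' : Ideal C} (h : L ≤ L')
    (h' : Ideal.span {F} * L' ≤ L) {P Q : Ideal A}
    (hP : ∀ g ∈ P, ∃ a ∈ L₁, ∃ b ∈ L₁', g = φ a + φ b * w)
    (hQ : ∀ g ∈ Q, ∃ a ∈ L₂, ∃ b ∈ L₂', g = φ a + φ b * w)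
    (h₁ : L₁ * L₂ ≤ L) (h₂ : Ideal.span {F} * (L₁' * L₂') ≤ L) (h₃ : L₁ * L₂' ≤ L')
    (h₄ : L₁' * L₂ ≤ L') :
    P * Q ≤ twistedIdeal φ w F hw (fun g => (huniq g).exists) L L' h h' := by
  rw [Ideal.mul_le]
  intro g hg g' hg'
  obtain ⟨a, ha, b, hb, rfl⟩ := hP g hg
  obtain ⟨a', ha', b', hb', rfl⟩ := hQ g' hg'
  refine ⟨a * a' + F * (b * b'), add_mem (h₁ (Ideal.mul_mem_mul ha ha'))
    (h₂ (Ideal.mul_mem_mul (Ideal.mem_span_singleton_self F) (Ideal.mul_mem_mul hb hb'))),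
    a * b' + b * a', add_mem (h₃ (Ideal.mul_mem_mul ha hb')) (h₄ (Ideal.mul_mem_mul hb ha')), ?_⟩
  simp only [map_add, map_mul, ← hw]
  ring

lemma exists_of_sup_span_le (hgen : ∀ g : A, ∃ c : C × C, g = φ c.1 + φ c.2 * w)
    {K : Ideal A} (hK : J.map φ ⊔ Ideal.span {w} ≤ K) :
    ∀ g ∈ K, ∃ a ∈ K.comap φ, ∃ b ∈ (⊤ : Ideal C), g = φ a + φ b * w := by
  intro g hg
  obtain ⟨⟨a, b⟩, rfl⟩ := hgen g
  refine ⟨a, ?_, b, trivial, rfl⟩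
  have hwK : w ∈ K := hK (le_sup_right (a := J.map φ) (Ideal.mem_span_singleton_self w))
  exact (Ideal.add_mem_iff_left K (Ideal.mul_mem_left _ _ hwK)).1 hg

include hF in
lemma span_mul_pow_le (m : ℕ) : Ideal.span {F} * J ^ m ≤ J ^ (m + 2) := by
  rw [add_comm, pow_add]
  exact Ideal.mul_mono_left ((Ideal.span_singleton_le_iff_mem _).2 hF)

include hw huniq hF in
lemma sup_span_eq_twistedIdeal :
    J.map φ ⊔ Ideal.span {w} = twistedIdeal φ w F hw (fun g => (huniq g).exists) J ⊤ le_top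
      (Ideal.mul_le_left.trans
        ((Ideal.span_singleton_le_iff_mem _).2 (Ideal.pow_le_self two_ne_zero hF))) := by
  apply le_antisymm
  · refine sup_le (Ideal.map_le_iff_le_comap.2 fun a ha => ⟨a, ha, 0, trivial, by simp⟩)
      ((Ideal.span_singleton_le_iff_mem _).2 ⟨0, zero_mem _, 1, trivial, by simp⟩)
  · rintro _ ⟨a, ha, b, -, rfl⟩
    exact add_mem (le_sup_left (a := J.map φ) (b := Ideal.span {w}) (Ideal.mem_map_of_mem φ ha))
      (Ideal.mul_mem_left _ _
        (le_sup_right (a := J.map φ) (b := Ideal.span {w}) (Ideal.mem_span_singleton_self w)))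

include hw huniq hF in
lemma comap_sup_span : (J.map φ ⊔ Ideal.span {w}).comap φ = J := by
  rw [sup_span_eq_twistedIdeal hw huniq hF]
  ext a
  have := mem_twistedIdeal_iff hw huniq (L := J) (L' := ⊤) le_top (Ideal.mul_le_left.trans
      ((Ideal.span_singleton_le_iff_mem _).2 (Ideal.pow_le_self two_ne_zero hF))) a 0
  simpa using this

include hw huniq hF in
-- The square `w ^ 2 = F` lies in `J`, so `w` is nilpotent modulo `J A`, while killing `w` leaves
-- the reduced ring `C / J`.
lemma radical_map_eq_sup_span (hJ : J.IsRadical) :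
    (J.map φ).radical = J.map φ ⊔ Ideal.span {w} := by
  apply le_antisymm
  · set I := J.map φ ⊔ Ideal.span {w} with hI
    have hwI : w ∈ I := le_sup_right (a := J.map φ) (Ideal.mem_span_singleton_self w)
    have hJI : J.map φ ≤ I := le_sup_left
    rintro g ⟨n, hg⟩
    obtain ⟨⟨a, b⟩, rfl⟩ := (huniq g).exists
    have hg' : (φ a + φ b * w) ^ n ∈ I := hJI hg
    have h1 : φ a - (φ a + φ b * w) ∈ I := by
      have := I.mul_mem_left (-φ b) hwI
      convert this using 1
      ring
    have h2 := I.mem_of_dvd (sub_dvd_pow_sub_pow _ _ n) h1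
    have h3 : φ (a ^ n) ∈ I := by
      rw [map_pow]
      exact (Submodule.sub_mem_iff_left _ hg').1 h2
    rw [← Ideal.mem_comap, hI, comap_sup_span hw huniq hF] at h3
    exact add_mem (hJI (Ideal.mem_map_of_mem φ (hJ ⟨n, h3⟩))) (I.mul_mem_left _ hwI)
  · rw [sup_le_iff, Ideal.span_singleton_le_iff_mem]
    refine ⟨Ideal.le_radical, 2, ?_⟩
    rw [hw]
    exact Ideal.mem_map_of_mem φ (Ideal.pow_le_self two_ne_zero hF)

include hw huniq hF in
-- Multiplicity two enters here: a product of two `w`-terms contributes `F`, which lies in `J ^ 2`,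
-- so the first coordinate stays in the expected power.
lemma exists_of_mem_sup_span_pow_succ (m : ℕ) :
    ∀ g ∈ (J.map φ ⊔ Ideal.span {w}) ^ (m + 1),
      ∃ a ∈ J ^ (m + 1), ∃ b ∈ J ^ m, g = φ a + φ b * w := by
  induction m with
  | zero =>
    intro g hg
    rw [zero_add, pow_one] at hg ⊢
    obtain ⟨a, ha, b, -, e⟩ := exists_of_sup_span_le (fun g => (huniq g).exists) le_rfl g hg
    rw [comap_sup_span hw huniq hF] at ha
    exact ⟨a, ha, b, by simp, e⟩
  | succ m ih =>
    intro g hg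
    rw [pow_succ] at hg
    have h1 : Ideal.span {F} * J ^ (m + 1) ≤ J ^ (m + 2) :=
      (span_mul_pow_le hF _).trans (Ideal.pow_le_pow_right (by omega))
    have := mul_le_twistedIdeal hw huniq (L := J ^ (m + 1 + 1)) (L' := J ^ (m + 1))
      (L₁ := J ^ (m + 1)) (L₁' := J ^ m) (L₂ := J) (L₂' := ⊤)
      (Ideal.pow_le_pow_right (by omega)) h1 ih (fun g hg => by
        have := exists_of_sup_span_le (fun g => (huniq g).exists) le_rfl g hg
        rwa [comap_sup_span hw huniq hF] at this)
      (by rw [← pow_succ]) (by rw [Ideal.mul_top]; exact span_mul_pow_le hF _)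
      (by rw [Ideal.mul_top]) (by rw [← pow_succ]) hg
    exact this

include hw huniq hF in
-- As `w ∈ K`, multiplication by `s = s₀ + s₁ w` modulo `K` is multiplication by `s₀`. Comparing
-- coordinates of `s y`, the cross terms `s₁ F b` and `s₁ a` already lie in the required ideals, so
-- normal flatness of `J` applies to `a` and `b` separately.
lemma IsNormallyFlat.map_sup_span (hJ : IsNormallyFlat J) :
    IsNormallyFlat (J.map φ ⊔ Ideal.span {w}) := by
  intro K hK s hs m
  set I := J.map φ ⊔ Ideal.span {w} with hI
  have hwI : w ∈ I := le_sup_right (a := J.map φ) (Ideal.mem_span_singleton_self w)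
  have hmapI : J.map φ ≤ I := le_sup_left
  -- The decomposition of `I ^ m` involves `J ^ (m - 1)`, so degree zero is separate.
  rcases m with - | m
  · intro y _ hy
    rw [pow_zero, Ideal.one_eq_top, Ideal.mul_top] at hy ⊢
    exact hs y hy
  intro y hy hsy
  obtain ⟨a, ha, b, hb, rfl⟩ := exists_of_mem_sup_span_pow_succ hw huniq hF m y hy
  set K₀ := K.comap φ with hK₀
  have hJK : J ≤ K₀ := Ideal.map_le_iff_le_comap.1 (hmapI.trans hK)
  have hFJ : ∀ k, Ideal.span {F} * J ^ k ≤ K₀ * J ^ (k + 1) := fun k =>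
    (span_mul_pow_le hF _).trans (by rw [pow_succ' _ (k + 1)]; exact Ideal.mul_mono_left hJK)
  have hKtwist := mul_le_twistedIdeal hw huniq (L := K₀ * J ^ (m + 1)) (L' := K₀ * J ^ m)
      (L₁ := K₀) (L₁' := ⊤) (L₂ := J ^ (m + 1)) (L₂' := J ^ m)
      (Ideal.mul_mono_right (Ideal.pow_le_pow_right (by omega)))
      (by rw [mul_left_comm]
          exact Ideal.mul_mono_right ((span_mul_pow_le hF _).trans
            (Ideal.pow_le_pow_right (by omega))))
      (exists_of_sup_span_le (fun g => (huniq g).exists) hK)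
      (exists_of_mem_sup_span_pow_succ hw huniq hF m) le_rfl
      (by rw [Ideal.top_mul]; exact hFJ m) le_rfl
      (by rw [Ideal.top_mul, pow_succ']; exact Ideal.mul_mono_left hJK)
  obtain ⟨⟨s₀, s₁⟩, rfl⟩ := (huniq s).exists
  have hs₀ : ∀ c, s₀ * c ∈ K₀ → c ∈ K₀ := by
    intro c hc
    refine hs _ ?_
    have : (φ s₀ + φ s₁ * w) * φ c = φ (s₀ * c) + φ (s₁ * c) * w := by
      simp only [map_mul]; ring
    rw [this]
    exact add_mem hc (Ideal.mul_mem_left _ _ (hK hwI))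
  have h1 := hKtwist hsy
  have h2 : (φ s₀ + φ s₁ * w) * (φ a + φ b * w) =
      φ (s₀ * a + s₁ * (F * b)) + φ (s₀ * b + s₁ * a) * w := by
    simp only [map_add, map_mul, ← hw]; ring
  rw [h2, mem_twistedIdeal_iff hw huniq] at h1
  have hFb : F * b ∈ K₀ * J ^ (m + 1) :=
    hFJ m (Ideal.mul_mem_mul (Ideal.mem_span_singleton_self F) hb)
  have ha' : a ∈ K₀ * J ^ m := by
    rw [pow_succ'] at ha
    exact Ideal.mul_mono_left hJK ha
  have h3 : a ∈ K₀ * J ^ (m + 1) := hJ K₀ hJK s₀ hs₀ _ a ha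
    ((Ideal.add_mem_iff_left _ (Ideal.mul_mem_left _ _ hFb)).1 h1.1)
  have h4 : b ∈ K₀ * J ^ m := hJ K₀ hJK s₀ hs₀ _ b hb
    ((Ideal.add_mem_iff_left _ (Ideal.mul_mem_left _ _ ha')).1 h1.2)
  have h5 : ∀ k, (K₀ * J ^ k).map φ ≤ K * I ^ k := fun k => by
    rw [Ideal.map_mul, Ideal.map_pow]
    exact Ideal.mul_mono Ideal.map_comap_le (Ideal.pow_right_mono hmapI _)
  refine add_mem (h5 _ (Ideal.mem_map_of_mem _ h3)) ?_
  rw [pow_succ, ← mul_assoc]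
  exact Ideal.mul_mem_mul (h5 _ (Ideal.mem_map_of_mem _ h4)) hwI

end QuadraticAlgebra

/-! ### Local algebra of blow-up charts -/

section BlowUpChart

variable {O O' : Type*} [CommRing O] [CommRing O']

/-- `c` is a denominator of degree `n`: an element of `I ^ n` whose image is `σ a ^ n` up to a
unit. -/
def IsChartDenom (σ : O →+* O') (I : Ideal O) (a : O) (n : ℕ) (c : O) : Prop :=
  c ∈ I ^ n ∧ ∃ u : O'ˣ, σ c = σ a ^ n * u

/-- `O'` is a localization of the affine blow-up algebra `O[I / a]`. -/
structure IsBlowUpChart (σ : O →+* O') (I : Ideal O) (a : O) : Prop where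
  mem : a ∈ I
  map_mem_nonZeroDivisors : σ a ∈ nonZeroDivisors O'
  map_eq_span : I.map σ = Ideal.span {σ a}
  surj : ∀ z : O', ∃ n c y, IsChartDenom σ I a n c ∧ y ∈ I ^ n ∧ z * σ c = σ y
  exists_mul_eq_zero : ∀ y : O, σ y = 0 → ∃ n c, IsChartDenom σ I a n c ∧ c * y = 0

namespace IsBlowUpChart

variable {σ : O →+* O'} {I : Ideal O} {a : O} (h : IsBlowUpChart σ I a)

include h in
lemma denom_mem_nonZeroDivisors {n : ℕ} {c : O} (hc : IsChartDenom σ I a n c) :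
    σ c ∈ nonZeroDivisors O' := by
  obtain ⟨-, u, hu⟩ := hc
  rw [hu]
  exact mul_mem (pow_mem h.map_mem_nonZeroDivisors n) u.isUnit.mem_nonZeroDivisors

include h in
-- After clearing denominators a relation `z σ(f) = 0` descends to `O`, up to one more denominator,
-- and all denominators map to non-zero-divisors.
lemma map_nonZeroDivisors {f : O} (hf : f ∈ nonZeroDivisors O) : σ f ∈ nonZeroDivisors O' := by
  rw [mem_nonZeroDivisors_iff_right]
  intro z hz
  obtain ⟨n, c, y, hc, -, e⟩ := h.surj z
  have h1 : σ (y * f) = 0 := by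
    rw [map_mul, ← e, mul_right_comm, hz, zero_mul]
  obtain ⟨k, d, hd, h2⟩ := h.exists_mul_eq_zero _ h1
  rw [← mul_assoc] at h2
  have h3 := (mem_nonZeroDivisors_iff_right.1 hf) _ h2
  have h4 : z * (σ c * σ d) = 0 := by
    rw [← mul_assoc, e, ← map_mul, mul_comm, h3, map_zero]
  exact (mem_nonZeroDivisors_iff_right.1
    (mul_mem (h.denom_mem_nonZeroDivisors hc) (h.denom_mem_nonZeroDivisors hd))) _ h4

include h in
/-- If `t` is a non-zero-divisor modulo all powers of `I`, then a local equation of the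
exceptional divisor is a non-zero-divisor modulo `t`. -/
lemma mem_span_of_mul_mem {t : O} (ht : ∀ n y, t * y ∈ I ^ n → y ∈ I ^ n) {f : O'}
    (hf : I.map σ = Ideal.span {f}) {v : O'} (hv : f * v ∈ Ideal.span {σ t}) :
    v ∈ Ideal.span {σ t} := by
  have haf : σ a ∈ Ideal.span {f} := by
    rw [← hf, h.map_eq_span]; exact Ideal.mem_span_singleton_self _
  obtain ⟨r, hr⟩ := Ideal.mem_span_singleton'.1 haf
  obtain ⟨z, hz⟩ := Ideal.mem_span_singleton'.1 hv
  obtain ⟨n₁, c₁, y, hc₁, hy, e₁⟩ := h.surj v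
  obtain ⟨n₂, c₂, w, hc₂, hw, e₂⟩ := h.surj (r * z)
  -- With `σ a = r f` and `f v = z σ t`, the relation `σ a · v = r z · σ t` is written over `O`
  -- using fractions `y / c₁` for `v` and `w / c₂` for `r z`.
  have h1 : σ (a * c₂ * y - t * w * c₁) = 0 := by
    simp only [map_sub, map_mul, ← e₁, ← e₂, ← hr]
    linear_combination -(r * σ c₁ * σ c₂) * hz
  obtain ⟨k, d, hd, h2⟩ := h.exists_mul_eq_zero _ h1
  -- The exponent exceeds the total degree of the denominators by one, thanks to the factor `a`.
  -- This surplus, kept after cancelling `t`, makes `r z` divisible by `σ a`.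
  have h3 : d * w * c₁ ∈ I ^ (k + n₂ + n₁ + 1) := by
    refine ht _ _ ?_
    have : t * (d * w * c₁) = d * c₂ * y * a := by linear_combination -h2
    rw [this, pow_succ, pow_add, pow_add]
    exact Ideal.mul_mem_mul (Ideal.mul_mem_mul (Ideal.mul_mem_mul hd.1 hc₂.1) hy) h.mem
  have h4 := Ideal.mem_map_of_mem σ h3
  rw [Ideal.map_pow, h.map_eq_span, Ideal.span_singleton_pow] at h4
  obtain ⟨q, hq⟩ := Ideal.mem_span_singleton'.1 h4
  obtain ⟨u, hu⟩ := hd.2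
  obtain ⟨u₁, hu₁⟩ := hc₁.2
  obtain ⟨u₂, hu₂⟩ := hc₂.2
  have h5 : q * σ a = r * z * (u * u₁ * u₂ : O'ˣ) := by
    refine (mul_cancel_right_mem_nonZeroDivisors
      (pow_mem h.map_mem_nonZeroDivisors (k + n₂ + n₁))).1 ?_
    have h6 : σ (d * w * c₁) = r * z * (σ c₂ * σ d * σ c₁) := by
      simp only [map_mul, ← e₂]; ring
    rw [h6, hu, hu₁, hu₂] at hq
    push_cast
    linear_combination hq
  refine Ideal.mem_span_singleton'.2 ⟨q * (u * u₁ * u₂)⁻¹.val, ?_⟩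
  refine (mul_cancel_right_mem_nonZeroDivisors h.map_mem_nonZeroDivisors).1 ?_
  calc q * (u * u₁ * u₂)⁻¹.val * σ t * σ a
      = r * z * ((u * u₁ * u₂ : O'ˣ) * (u * u₁ * u₂)⁻¹.val) * σ t := by
        linear_combination (u * u₁ * u₂)⁻¹.val * σ t * h5
    _ = v * σ a := by rw [Units.mul_inv, ← hr]; linear_combination r * hz

end IsBlowUpChart

/-- If no element of `I` mapped to a unit multiple of `f`, then `I O'` would lie in `f` times the
maximal ideal, which is impossible for a non-zero-divisor `f`. -/
lemma exists_mem_map_eq_span [IsLocalRing O'] {σ : O →+* O'} {I : Ideal O} {f : O'}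
    (hf : f ∈ nonZeroDivisors O') (h : I.map σ = Ideal.span {f}) :
    ∃ a ∈ I, σ a ∈ nonZeroDivisors O' ∧ I.map σ = Ideal.span {σ a} := by
  by_cases hI : ∃ a ∈ I, ∃ u : O'ˣ, σ a = f * u
  · obtain ⟨a, ha, u, e⟩ := hI
    refine ⟨a, ha, ?_, ?_⟩
    · rw [e]; exact mul_mem hf u.isUnit.mem_nonZeroDivisors
    · rw [h, e, Ideal.span_singleton_mul_right_unit u.isUnit]
  · exfalso
    push Not at hI
    have h1 : I.map σ ≤ Ideal.span {f} * IsLocalRing.maximalIdeal O' := by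
      rw [Ideal.map_le_iff_le_comap]
      intro a ha
      have h2 := Ideal.mem_map_of_mem σ ha
      rw [h] at h2
      obtain ⟨q, hq⟩ := Ideal.mem_span_singleton.1 h2
      rw [Ideal.mem_comap, hq]
      refine Ideal.mul_mem_mul (Ideal.mem_span_singleton_self f) ?_
      rw [IsLocalRing.mem_maximalIdeal]
      intro hu
      exact hI a ha hu.unit hq
    rw [h, Ideal.span_singleton_le_iff_mem, Ideal.mem_span_singleton_mul] at h1
    obtain ⟨m, hm, e⟩ := h1
    have h3 : m = 1 := (mul_cancel_left_mem_nonZeroDivisors hf).1 (by rw [e, mul_one])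
    rw [h3] at hm
    exact (Ideal.ne_top_iff_one _).1 (IsLocalRing.maximalIdeal.isMaximal O').ne_top hm

end BlowUpChart

/-! ### Minimal primes of a radical ideal and of a reduced principal divisor -/

section MinimalPrimes

variable {O : Type*} [CommRing O]

lemma mem_of_mul_mem_of_forall_notMem_minimalPrimes {I : Ideal O} (hI : I.IsRadical) {t : O}
    (ht : ∀ p ∈ I.minimalPrimes, t ∉ p) {y : O} (hy : t * y ∈ I) : y ∈ I := by
  rw [← hI.radical, ← Ideal.sInf_minimalPrimes, Ideal.mem_sInf]
  intro p hp
  exact (hp.1.1.mem_or_mem (hp.1.2 hy)).resolve_left (ht p hp)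

/-- Otherwise `I` avoids every `s x ^ n` with `s ∉ p`, and a prime over `I` avoiding them all lies
in `p` but misses `x`, against minimality. -/
lemma exists_mul_mem_of_mem_minimalPrimes {I p : Ideal O} (hI : I.IsRadical)
    (hp : p ∈ I.minimalPrimes) {x : O} (hx : x ∈ p) : ∃ s ∉ p, s * x ∈ I := by
  by_contra! hcon
  have := hp.1.1
  have hdisj : Disjoint (I : Set O) (p.primeCompl ⊔ Submonoid.powers x : Submonoid O) := by
    rw [Set.disjoint_left]
    intro y hy hyS
    obtain ⟨s, hs, _, ⟨n, rfl⟩, rfl⟩ := Submonoid.mem_sup.1 hyS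
    refine hcon s hs (hI ⟨n + 1, ?_⟩)
    have : (s * x) ^ (n + 1) = s ^ n * x * (s * x ^ n) := by ring
    rw [this]
    exact Ideal.mul_mem_left _ _ hy
  obtain ⟨q, hq, hIq, hqS⟩ := Ideal.exists_le_prime_disjoint I _ hdisj
  have hqp : q ≤ p := fun y hy => by
    by_contra hyp
    exact Set.disjoint_left.1 hqS hy
      ((le_sup_left : p.primeCompl ≤ p.primeCompl ⊔ Submonoid.powers x) hyp)
  exact Set.disjoint_left.1 hqS (hp.2 ⟨hq, hIq⟩ hqp hx)
    ((le_sup_right : Submonoid.powers x ≤ p.primeCompl ⊔ Submonoid.powers x)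
      (Submonoid.mem_powers x))

lemma eq_bot_of_le_span_mul [IsLocalRing O] {t : O} (ht : t ∈ IsLocalRing.maximalIdeal O)
    {N : Ideal O} (hN : N.FG) (h : N ≤ Ideal.span {t} * N) : N = ⊥ := by
  refine Submodule.eq_bot_of_le_smul_of_le_jacobson_bot (Ideal.span {t}) N hN h ?_
  rw [IsLocalRing.jacobson_eq_maximalIdeal _ bot_ne_top, Ideal.span_singleton_le_iff_mem]
  exact ht

/-- The annihilator `N` of `h` satisfies `N = t N`: if `h y = 0` then `y = t z`, and `h z = 0`
because `t` cancels. Nakayama gives `N = 0`. -/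
lemma mem_nonZeroDivisors_of_mul_mem_span [IsLocalRing O] [IsNoetherianRing O] {t : O}
    (htm : t ∈ IsLocalRing.maximalIdeal O) (ht : t ∈ nonZeroDivisors O) {h : O}
    (hh : ∀ y, h * y ∈ Ideal.span {t} → y ∈ Ideal.span {t}) : h ∈ nonZeroDivisors O := by
  have hN : (⊥ : Ideal O).colon {h} = ⊥ := by
    refine eq_bot_of_le_span_mul htm (IsNoetherian.noetherian _) fun y hy => ?_
    rw [Submodule.mem_colon_singleton, smul_eq_mul, Ideal.mem_bot] at hy
    obtain ⟨z, rfl⟩ := Ideal.mem_span_singleton.1 (hh y (by rw [mul_comm, hy]; exact zero_mem _))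
    refine Ideal.mul_mem_mul (Ideal.mem_span_singleton_self t) ?_
    rw [Submodule.mem_colon_singleton, smul_eq_mul, Ideal.mem_bot]
    rw [mul_assoc] at hy
    exact mem_nonZeroDivisors_iff_left.1 ht _ hy
  rw [mem_nonZeroDivisors_iff_right]
  intro y hy
  have : y ∈ (⊥ : Ideal O).colon {h} := by
    rw [Submodule.mem_colon_singleton, smul_eq_mul, Ideal.mem_bot, hy]
  rwa [hN] at this

/-- A prime strictly below a minimal prime of a reduced principal divisor is an associated point
of the ring only: it contains no non-zero-divisor. -/
lemma notMem_of_lt_minimalPrimes [IsNoetherianRing O] {t : O}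
    (hred : (Ideal.span {t}).IsRadical) {p q : Ideal O} (hp : p ∈ (Ideal.span {t}).minimalPrimes)
    [hq : q.IsPrime] (hqp : q < p) {f : O} (hf : f ∈ nonZeroDivisors O) : f ∉ q := by
  intro hfq
  have := hp.1.1
  have htp : t ∈ p := hp.1.2 (Ideal.mem_span_singleton_self t)
  have htq : t ∉ q := fun h => hqp.not_ge
    (hp.2 ⟨hq, (Ideal.span_singleton_le_iff_mem _).2 h⟩ hqp.le)
  let B := Localization.AtPrime p
  -- Up to a unit of `B`, each element of `q` is some `t y` by radicality, and `y ∈ q` as `t ∉ q`.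
  -- So `q B = t q B`, and Nakayama applies.
  have hN : q.map (algebraMap O B) = ⊥ := by
    have : IsNoetherianRing B := IsLocalization.isNoetherianRing p.primeCompl B ‹_›
    refine eq_bot_of_le_span_mul (t := algebraMap O B t)
      ((IsLocalization.AtPrime.to_map_mem_maximal_iff B p t).2 htp) (IsNoetherian.noetherian _) ?_
    rw [Ideal.map_le_iff_le_comap]
    intro x hx
    obtain ⟨s, hs, hsx⟩ := exists_mul_mem_of_mem_minimalPrimes hred hp (hqp.le hx)
    obtain ⟨y, hy⟩ := Ideal.mem_span_singleton.1 hsx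
    have hyq : y ∈ q := (hq.mem_or_mem (hy ▸ Ideal.mul_mem_left _ _ hx)).resolve_left htq
    have hs' : IsUnit (algebraMap O B s) := IsLocalization.map_units B (⟨s, hs⟩ : p.primeCompl)
    rw [Ideal.mem_comap]
    refine (Ideal.unit_mul_mem_iff_mem _ hs').1 ?_
    rw [← map_mul, hy, map_mul]
    exact Ideal.mul_mem_mul (Ideal.mem_span_singleton_self _) (Ideal.mem_map_of_mem _ hyq)
  have h1 := Ideal.mem_map_of_mem (algebraMap O B) hfq
  rw [hN, Ideal.mem_bot, IsLocalization.map_eq_zero_iff p.primeCompl] at h1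
  obtain ⟨s, hs⟩ := h1
  have := mem_nonZeroDivisors_iff_right.1 hf _ hs
  exact s.2 (this ▸ zero_mem p)

/-- A quotient `f / g` which is a unit at all minimal primes of `I` is a quotient of elements
outside of all these primes. -/
lemma exists_mul_eq_mul_of_forall_minimalPrimes [IsNoetherianRing O] {I : Ideal O} {f g : O}
    (hg : g ∈ nonZeroDivisors O)
    (h : ∀ p ∈ I.minimalPrimes, ∃ s ∉ p, ∃ s' ∉ p, f * s = g * s') :
    ∃ f' g' : O, f * g' = g * f' ∧ ∀ p ∈ I.minimalPrimes, f' ∉ p ∧ g' ∉ p := by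
  let 𝔞 : Ideal O := (Ideal.span {g}).colon {f}
  -- By prime avoidance, if all possible denominators lay in the union of the finitely many minimal
  -- primes, `𝔞` would lie in a single `p`; but `𝔞` contains some `s ∉ p`.
  have h1 : ∃ g' ∈ 𝔞, ∀ p ∈ I.minimalPrimes, g' ∉ p := by
    by_contra! hcon
    have hfin := Ideal.finite_minimalPrimes_of_isNoetherianRing O I
    have := (Ideal.subset_union_prime_finite hfin (f := fun p => p) ⊤ ⊤
      (fun p hp _ _ => hp.1.1) (I := 𝔞)).1 (fun x hx => by
        obtain ⟨p, hp, hxp⟩ := hcon x hx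
        exact Set.mem_biUnion hp hxp)
    obtain ⟨p, hp, hle⟩ := this
    obtain ⟨s, hs, s', -, e⟩ := h p hp
    refine hs (hle ?_)
    rw [Submodule.mem_colon_singleton, smul_eq_mul, mul_comm, e]
    exact Ideal.mem_span_singleton.2 ⟨s', rfl⟩
  obtain ⟨g', hg', hnot⟩ := h1
  rw [Submodule.mem_colon_singleton, smul_eq_mul] at hg'
  obtain ⟨f', hf'⟩ := Ideal.mem_span_singleton.1 hg'
  refine ⟨f', g', by rw [mul_comm, hf'], fun p hp => ⟨fun hfp => ?_, hnot p hp⟩⟩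
  obtain ⟨s, -, s', hs', e⟩ := h p hp
  have h2 : g' * s' = f' * s := by
    refine (mul_cancel_left_mem_nonZeroDivisors hg).1 ?_
    linear_combination s * hf' - g' * e
  exact (hp.1.1.mem_or_mem (h2 ▸ Ideal.mul_mem_right _ _ hfp)).elim (hnot p hp) hs'

end MinimalPrimes

end FamilyBlowUp

namespace FamilyBlowUp

variable {X Y : Scheme.{u}}

/-! ### Inverse images and stalks of ideal sheaves -/

section IdealSheaf

/-- Both ideals have the same upper bounds, by the adjunction between `comap` and `map` for ideal
sheaves and for ideals. -/
lemma ideal_comap_top_of_isAffine [IsAffine X] [IsAffine Y] (I : Y.IdealSheafData) (f : X ⟶ Y) :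
    (I.comap f).ideal ⟨⊤, isAffineOpen_top X⟩ =
      (I.ideal ⟨⊤, isAffineOpen_top Y⟩).map f.appTop.hom := by
  refine eq_of_forall_ge_iff fun J => ?_
  obtain ⟨J, rfl⟩ := Scheme.IdealSheafData.equivOfIsAffine.surjective J
  rw [Ideal.map_le_iff_le_comap]
  have h1 := J.ideal_map_of_isAffineHom f ⟨⊤, isAffineOpen_top Y⟩
  have h2 : I.ideal ⟨⊤, isAffineOpen_top Y⟩ ≤ (J.map f).ideal ⟨⊤, isAffineOpen_top Y⟩ ↔
      I ≤ J.map f := ⟨Scheme.IdealSheafData.le_of_isAffine, fun h => h _⟩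
  rw [h1] at h2
  refine Iff.trans ?_ h2.symm
  rw [Scheme.IdealSheafData.le_map_iff_comap_le]
  exact ⟨Scheme.IdealSheafData.le_of_isAffine, fun h => h _⟩

lemma ideal_comap_of_isOpenImmersion (I : Y.IdealSheafData) (j : X ⟶ Y) [IsOpenImmersion j]
    (V : X.affineOpens) (W : Y.affineOpens) (h : W.1 = j ''ᵁ V.1) (h' : V.1 ≤ j ⁻¹ᵁ W.1) :
    IsIso (j.appLE W.1 V.1 h') ∧
      (I.comap j).ideal V = (I.ideal W).map (j.appLE W.1 V.1 h').hom := by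
  obtain ⟨W, hW⟩ := W
  obtain rfl : W = j ''ᵁ V.1 := h
  have e : j.appLE (j ''ᵁ V.1) V.1 h' = (j.appIso V.1).hom := by
    rw [Scheme.Hom.appIso_hom']
  refine ⟨e ▸ inferInstance, ?_⟩
  rw [Scheme.IdealSheafData.ideal_comap_of_isOpenImmersion]
  change _ = Ideal.map (j.appLE (j ''ᵁ V.1) V.1 h').hom _
  rw [e]
  exact (Ideal.map_comap_of_equiv (j.appIso V.1).commRingCatIsoToRingEquiv).symm

lemma ideal_comap (I : Y.IdealSheafData) (f : X ⟶ Y) (U : Y.affineOpens) (V : X.affineOpens)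
    (h : V.1 ≤ f ⁻¹ᵁ U.1) :
    (I.comap f).ideal V = (I.ideal U).map (f.appLE U.1 V.1 h).hom := by
  have : IsAffine U.1 := U.2
  have : IsAffine V.1 := V.2
  let g : (V.1 : Scheme.{u}) ⟶ U.1 := IsOpenImmersion.lift U.1.ι (V.1.ι ≫ f) (by
    rintro _ ⟨x, rfl⟩
    rw [Scheme.Opens.range_ι]
    exact h x.2)
  have hg : g ≫ U.1.ι = V.1.ι ≫ f := IsOpenImmersion.lift_fac _ _ _
  have hV : (⊤ : V.1.toScheme.Opens) ≤ V.1.ι ⁻¹ᵁ V.1 := by simp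
  have hU : (⊤ : U.1.toScheme.Opens) ≤ U.1.ι ⁻¹ᵁ U.1 := by simp
  obtain ⟨_, h1⟩ := ideal_comap_of_isOpenImmersion (I.comap f) V.1.ι
    ⟨⊤, isAffineOpen_top V.1⟩ V (by simp) hV
  obtain ⟨_, h2⟩ := ideal_comap_of_isOpenImmersion I U.1.ι
    ⟨⊤, isAffineOpen_top U.1⟩ U (by simp) hU
  rw [← Scheme.IdealSheafData.comap_comp, ← hg, Scheme.IdealSheafData.comap_comp,
    ideal_comap_top_of_isAffine, h2, Ideal.map_map, ← CommRingCat.hom_comp] at h1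
  have h3 : U.1.ι.appLE U.1 ⊤ hU ≫ g.appTop = f.appLE U.1 V.1 h ≫ V.1.ι.appLE V.1 ⊤ hV := by
    have hg' : (⊤ : V.1.toScheme.Opens) ≤ g ⁻¹ᵁ ⊤ := fun _ _ => trivial
    have e : g.appTop = g.appLE ⊤ ⊤ hg' := by
      simp [Scheme.Hom.appTop, Scheme.Hom.app_eq_appLE]
    rw [e, Scheme.Hom.appLE_comp_appLE, Scheme.Hom.appLE_comp_appLE]
    simp only [hg]
  rw [h3, CommRingCat.hom_comp, ← Ideal.map_map] at h1
  have hbij : Function.Bijective (V.1.ι.appLE V.1 ⊤ hV).hom :=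
    (asIso (V.1.ι.appLE V.1 ⊤ hV)).commRingCatIsoToRingEquiv.bijective
  have h4 := congrArg (Ideal.comap (V.1.ι.appLE V.1 ⊤ hV).hom) h1
  rw [Ideal.comap_map_of_bijective _ hbij, Ideal.comap_map_of_bijective _ hbij] at h4
  exact h4.symm

/-- The stalk of an ideal sheaf. -/
noncomputable def stalkIdeal (I : X.IdealSheafData) (x : X) : Ideal (X.presheaf.stalk x) :=
  ⨆ (U : X.affineOpens) (h : x ∈ U.1), (I.ideal U).map (X.presheaf.germ U.1 x h).hom

lemma map_germ_ideal_le (I : X.IdealSheafData) (U V : X.affineOpens) {x : X} (hU : x ∈ U.1)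
    (hV : x ∈ V.1) : (I.ideal U).map (X.presheaf.germ U.1 x hU).hom ≤
      (I.ideal V).map (X.presheaf.germ V.1 x hV).hom := by
  obtain ⟨_, ⟨W, hW, rfl⟩, hxW, hWle⟩ := X.isBasis_affineOpens.exists_subset_of_mem_open
    (show x ∈ U.1 ⊓ V.1 from ⟨hU, hV⟩) (U.1 ⊓ V.1).2
  have key : ∀ (U : X.affineOpens) (hU : x ∈ U.1) (h : (⟨W, hW⟩ : X.affineOpens) ≤ U),
      (I.ideal U).map (X.presheaf.germ U.1 x hU).hom =
        (I.ideal ⟨W, hW⟩).map (X.presheaf.germ W x hxW).hom := by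
    intro U hU h
    rw [← I.map_ideal h, Ideal.map_map, ← CommRingCat.hom_comp]
    congr 2
    exact (X.presheaf.germ_res (homOfLE h) x hxW).symm
  rw [key U hU fun y hy => (hWle hy).1, key V hV fun y hy => (hWle hy).2]

lemma stalkIdeal_eq (I : X.IdealSheafData) (U : X.affineOpens) {x : X} (hU : x ∈ U.1) :
    stalkIdeal I x = (I.ideal U).map (X.presheaf.germ U.1 x hU).hom :=
  le_antisymm (iSup₂_le fun V hV => map_germ_ideal_le I V U hV hU)
    (le_iSup₂_of_le U hU le_rfl)

lemma exists_affineOpen_mem (x : X) : ∃ U : X.affineOpens, x ∈ U.1 := by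
  obtain ⟨_, ⟨U, hU, rfl⟩, hx, -⟩ := X.isBasis_affineOpens.exists_subset_of_mem_open
    (Set.mem_univ x) isOpen_univ
  exact ⟨⟨U, hU⟩, hx⟩

lemma exists_affineOpen_mem_le {x : X} {O : X.Opens} (hx : x ∈ O) :
    ∃ U : X.affineOpens, x ∈ U.1 ∧ U.1 ≤ O := by
  obtain ⟨_, ⟨U, hU, rfl⟩, hx, h⟩ := X.isBasis_affineOpens.exists_subset_of_mem_open hx O.2
  exact ⟨⟨U, hU⟩, hx, h⟩

lemma stalkIdeal_comap (I : Y.IdealSheafData) (f : X ⟶ Y) (x : X) :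
    stalkIdeal (I.comap f) x = (stalkIdeal I (f x)).map (f.stalkMap x).hom := by
  obtain ⟨U, hU⟩ := exists_affineOpen_mem (f x)
  obtain ⟨V, hV, hVU⟩ := exists_affineOpen_mem_le (O := f ⁻¹ᵁ U.1) hU
  rw [stalkIdeal_eq _ V hV, stalkIdeal_eq _ U hU, ideal_comap I f U V hVU, Ideal.map_map,
    Ideal.map_map, ← CommRingCat.hom_comp, ← CommRingCat.hom_comp]
  congr 2
  rw [Scheme.Hom.germ_stalkMap, Scheme.Hom.appLE, Category.assoc, TopCat.Presheaf.germ_res]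

lemma mem_support_iff_stalkIdeal_ne_top (I : X.IdealSheafData) (x : X) :
    x ∈ I.support ↔ stalkIdeal I x ≠ ⊤ := by
  obtain ⟨U, hU⟩ := exists_affineOpen_mem x
  have key (J : Ideal (X.presheaf.stalk x)) : J ≠ ⊤ ↔ J ≤ IsLocalRing.maximalIdeal _ :=
    ⟨IsLocalRing.le_maximalIdeal, fun h h' =>
      (IsLocalRing.maximalIdeal.isMaximal _).ne_top (top_le_iff.1 (h' ▸ h))⟩
  rw [Scheme.IdealSheafData.mem_support_iff_of_mem hU, stalkIdeal_eq I U hU, key,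
    Ideal.map_le_iff_le_comap]
  simp only [Scheme.mem_zeroLocus_iff]
  refine forall₂_congr fun f hf => ?_
  rw [Scheme.mem_basicOpen _ _ _ hU]
  rfl

lemma exists_mul_germ_eq (U : X.affineOpens) {x : X} (hx : x ∈ U.1) (a : X.presheaf.stalk x) :
    ∃ s d : Γ(X, U.1), IsUnit (X.presheaf.germ U.1 x hx d) ∧
      a * X.presheaf.germ U.1 x hx d = X.presheaf.germ U.1 x hx s := by
  let _ := TopCat.Presheaf.algebra_section_stalk X.presheaf (⟨x, hx⟩ : U.1)
  have := U.2.isLocalization_stalk ⟨x, hx⟩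
  obtain ⟨⟨s, d⟩, h⟩ := IsLocalization.surj
    (U.2.primeIdealOf ⟨x, hx⟩).asIdeal.primeCompl a
  exact ⟨s, d, IsLocalization.map_units (M := (U.2.primeIdealOf ⟨x, hx⟩).asIdeal.primeCompl)
    (X.presheaf.stalk x) d, h⟩

lemma exists_mul_mem_of_germ_mem (U : X.affineOpens) {x : X} (hx : x ∈ U.1) {I : Ideal Γ(X, U.1)}
    {s : Γ(X, U.1)} (h : X.presheaf.germ U.1 x hx s ∈ I.map (X.presheaf.germ U.1 x hx).hom) :
    ∃ d : Γ(X, U.1), IsUnit (X.presheaf.germ U.1 x hx d) ∧ d * s ∈ I := by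
  let _ := TopCat.Presheaf.algebra_section_stalk X.presheaf (⟨x, hx⟩ : U.1)
  have := U.2.isLocalization_stalk ⟨x, hx⟩
  obtain ⟨d, hd, hds⟩ := exists_mul_mem_of_algebraMap_mem_map
    (U.2.primeIdealOf ⟨x, hx⟩).asIdeal.primeCompl (B := X.presheaf.stalk x) h
  exact ⟨d, IsLocalization.map_units (M := (U.2.primeIdealOf ⟨x, hx⟩).asIdeal.primeCompl)
    (X.presheaf.stalk x) ⟨d, hd⟩, hds⟩

lemma exists_mul_eq_zero_of_germ_eq_zero (U : X.affineOpens) {x : X} (hx : x ∈ U.1)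
    {s : Γ(X, U.1)} (h : X.presheaf.germ U.1 x hx s = 0) :
    ∃ d : Γ(X, U.1), IsUnit (X.presheaf.germ U.1 x hx d) ∧ d * s = 0 :=
  exists_mul_mem_of_germ_mem (I := ⊥) U hx (by rw [h]; exact zero_mem _)

/-- Over an affine open, `f` is a surjection on sections, so a denominator killing a germ lifts; its
lift is a unit at `f x` because the stalk map is local. -/
lemma ker_stalkMap (f : X ⟶ Y) [IsClosedImmersion f] (x : X) :
    RingHom.ker (f.stalkMap x).hom = stalkIdeal f.ker (f x) := by
  obtain ⟨U, hU⟩ := exists_affineOpen_mem (f x)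
  rw [stalkIdeal_eq _ U hU, Scheme.Hom.ker_apply]
  apply le_antisymm
  · intro a ha
    obtain ⟨s, d, hd, e⟩ := exists_mul_germ_eq U hU a
    refine (Ideal.mul_unit_mem_iff_mem _ hd).1 ?_
    rw [e]
    have h1 : f.stalkMap x (Y.presheaf.germ U.1 (f x) hU s) = 0 := by
      rw [← e, map_mul]
      erw [RingHom.mem_ker.1 ha]
      rw [zero_mul]
    rw [Scheme.Hom.germ_stalkMap_apply] at h1
    obtain ⟨c, hc, h2⟩ := exists_mul_eq_zero_of_germ_eq_zero ⟨_, U.2.preimage f⟩ hU h1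
    have hsurj : Function.Surjective (f.app U.1) := f.app_surjective U.1 U.2
    obtain ⟨c, rfl⟩ := hsurj c
    have hc' : IsUnit (Y.presheaf.germ U.1 (f x) hU c) := by
      refine (isUnit_map_iff (f.stalkMap x).hom _).1 ?_
      erw [Scheme.Hom.germ_stalkMap_apply]
      exact hc
    refine (Ideal.unit_mul_mem_iff_mem _ hc').1 ?_
    rw [← map_mul]
    refine Ideal.mem_map_of_mem _ ?_
    rw [RingHom.mem_ker]
    exact (map_mul _ _ _).trans h2
  · rw [Ideal.map_le_iff_le_comap]
    intro s hs
    rw [Ideal.mem_comap, RingHom.mem_ker]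
    have h1 : f.app U.1 s = 0 := hs
    erw [Scheme.Hom.germ_stalkMap_apply]
    rw [h1, map_zero]

lemma mem_nonZeroDivisors_of_germ (U : X.Opens) (f : Γ(X, U))
    (h : ∀ x (hx : x ∈ U), X.presheaf.germ U x hx f ∈ nonZeroDivisors (X.presheaf.stalk x)) :
    f ∈ nonZeroDivisors Γ(X, U) := by
  rw [mem_nonZeroDivisors_iff_right]
  intro g hg
  refine TopCat.Presheaf.section_ext X.sheaf U _ _ fun x hx => ?_
  have h1 := congrArg (X.presheaf.germ U x hx) hg
  rw [map_mul, map_zero] at h1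
  have := (mem_nonZeroDivisors_iff_right.1 (h x hx)) _ h1
  refine Eq.trans this (map_zero _).symm

lemma IsEffectiveCartier.exists_stalkIdeal_eq {I : X.IdealSheafData} (hI : IsEffectiveCartier I)
    (x : X) : ∃ f ∈ nonZeroDivisors (X.presheaf.stalk x), stalkIdeal I x = Ideal.span {f} := by
  obtain ⟨U, hx, f, hf, e⟩ := hI x
  refine ⟨_, germ_mem_nonZeroDivisors U f hf x hx, ?_⟩
  rw [stalkIdeal_eq I U hx, e, Ideal.map_span, Set.image_singleton]

end IdealSheaf

end FamilyBlowUp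

namespace FamilyBlowUp

/-! ### The affine blow-up algebra -/

section AffineBlowUp

variable {O : Type u} [CommRing O] (I : Ideal O) {a : O}

/-- The affine blow-up algebra `O[I / a]`, the subalgebra of `O[1 / a]` of all fractions
`y / a ^ n` with `y ∈ I ^ n`. -/
def affineBlowUp (ha : a ∈ I) : Subalgebra O (Localization.Away a) where
  carrier := {z | ∃ n, ∃ y ∈ I ^ n, algebraMap O (Localization.Away a) (a ^ n) * z =
    algebraMap O (Localization.Away a) y}
  mul_mem' := by
    rintro z z' ⟨n, y, hy, e⟩ ⟨n', y', hy', e'⟩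
    refine ⟨n + n', y * y', by rw [pow_add]; exact Ideal.mul_mem_mul hy hy', ?_⟩
    rw [map_mul, ← e, ← e', pow_add, map_mul]
    ring
  add_mem' := by
    rintro z z' ⟨n, y, hy, e⟩ ⟨n', y', hy', e'⟩
    refine ⟨n + n', a ^ n' * y + a ^ n * y', add_mem ?_ ?_, ?_⟩
    · rw [add_comm, pow_add]; exact Ideal.mul_mem_mul (Ideal.pow_mem_pow ha _) hy
    · rw [pow_add]; exact Ideal.mul_mem_mul (Ideal.pow_mem_pow ha _) hy'
    · rw [map_add, map_mul, map_mul, ← e, ← e', pow_add, map_mul]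
      ring
  algebraMap_mem' r := ⟨0, r, by simp, by simp⟩

variable {I} (ha : a ∈ I)

lemma affineBlowUp_exists (z : affineBlowUp I ha) : ∃ n, ∃ y ∈ I ^ n,
    algebraMap O (affineBlowUp I ha) (a ^ n) * z = algebraMap O (affineBlowUp I ha) y := by
  obtain ⟨n, y, hy, e⟩ := z.2
  exact ⟨n, y, hy, Subtype.ext e⟩

lemma algebraMap_affineBlowUp_mem_nonZeroDivisors :
    algebraMap O (affineBlowUp I ha) a ∈ nonZeroDivisors (affineBlowUp I ha) := by
  rw [mem_nonZeroDivisors_iff_right]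
  intro z hz
  have h : IsUnit (algebraMap O (Localization.Away a) a) :=
    IsLocalization.Away.algebraMap_isUnit a
  refine Subtype.ext (h.mul_left_eq_zero.1 ?_)
  exact congrArg Subtype.val hz

lemma map_algebraMap_affineBlowUp :
    I.map (algebraMap O (affineBlowUp I ha)) = Ideal.span {algebraMap O (affineBlowUp I ha) a} := by
  apply le_antisymm
  · rw [Ideal.map_le_iff_le_comap]
    intro y hy
    obtain ⟨u, hu⟩ := IsLocalization.Away.algebraMap_isUnit (S := Localization.Away a) a
    have hz : algebraMap O (Localization.Away a) a * (u⁻¹.val * algebraMap O _ y) =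
        algebraMap O (Localization.Away a) y := by
      rw [← hu, Units.mul_inv_cancel_left]
    refine Ideal.mem_span_singleton.2 ⟨⟨u⁻¹.val * algebraMap O _ y, 1, y, by simpa using hy,
      by rw [pow_one, hz]⟩, Subtype.ext hz.symm⟩
  · rw [Ideal.span_singleton_le_iff_mem]
    exact Ideal.mem_map_of_mem _ ha

/-- Inside `O'[1 / σ a]`, which contains `O'`, the image of `y / a ^ n` lies in `O'` because `σ y`
is a multiple of `σ a ^ n`. -/
lemma exists_affineBlowUp_lift {O' : Type u} [CommRing O'] (σ : O →+* O')
    (hσ : σ a ∈ nonZeroDivisors O') (h : I.map σ = Ideal.span {σ a}) :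
    ∃ ψ : affineBlowUp I ha →+* O', ψ.comp (algebraMap O (affineBlowUp I ha)) = σ := by
  let ι := algebraMap O' (Localization.Away (σ a))
  have hι : Function.Injective ι :=
    IsLocalization.injective _ (Submonoid.powers_le.2 hσ)
  have hu : IsUnit (ι (σ a)) := IsLocalization.Away.algebraMap_isUnit (σ a)
  let L : Localization.Away a →+* Localization.Away (σ a) :=
    IsLocalization.Away.lift (g := ι.comp σ) a hu
  have hL (x : O) : L (algebraMap O _ x) = ι (σ x) := IsLocalization.Away.lift_eq a hu x
  have hmem (z : affineBlowUp I ha) : L z.1 ∈ ι.range := by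
    obtain ⟨z, n, y, hy, e⟩ := z
    have h1 := Ideal.mem_map_of_mem σ hy
    rw [Ideal.map_pow, h, Ideal.span_singleton_pow] at h1
    obtain ⟨q, hq⟩ := Ideal.mem_span_singleton'.1 h1
    refine ⟨q, (hu.pow n).mul_left_cancel ?_⟩
    have h2 := congrArg L e
    rw [map_mul, hL, hL, ← hq, map_pow, map_pow, map_mul, map_pow] at h2
    rw [h2, mul_comm]
  let e : O' ≃+* ι.range := RingEquiv.ofBijective ι.rangeRestrict
    ⟨fun x y hxy => hι (congrArg Subtype.val hxy), ι.rangeRestrict_surjective⟩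
  refine ⟨e.symm.toRingHom.comp ((L.comp (affineBlowUp I ha).val.toRingHom).codRestrict ι.range
    hmem), ?_⟩
  ext x
  refine e.injective (Subtype.ext ?_)
  refine (congrArg Subtype.val (e.apply_symm_apply _)).trans ?_
  exact hL x

end AffineBlowUp

/-! ### Morphisms from spectra to stalks, and the local rings of a blow-up -/

section Stalks

variable {X : Scheme.{u}}

lemma appLE_SpecMap_comp_fromSpecStalk {R : CommRingCat.{u}} {x : X}
    (ψ : X.presheaf.stalk x ⟶ R) (U : X.Opens) (hx : x ∈ U)
    (h : ⊤ ≤ (Spec.map ψ ≫ X.fromSpecStalk x) ⁻¹ᵁ U) :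
    (Spec.map ψ ≫ X.fromSpecStalk x).appLE U ⊤ h =
      X.presheaf.germ U x hx ≫ ψ ≫ (Scheme.ΓSpecIso R).inv := by
  have h1 : ⊤ ≤ X.fromSpecStalk x ⁻¹ᵁ U := by
    intro y _
    have : X.fromSpecStalk x y ∈ Set.range (X.fromSpecStalk x) := ⟨y, rfl⟩
    rw [Scheme.range_fromSpecStalk] at this
    exact this.mem_open U.2 hx
  have h2 : ⊤ ≤ Spec.map ψ ⁻¹ᵁ ⊤ := fun _ _ => trivial
  have h3 : (X.fromSpecStalk x).appLE U ⊤ h1 =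
      X.presheaf.germ U x hx ≫ (Scheme.ΓSpecIso (X.presheaf.stalk x)).inv := by
    have h4 : (Spec (X.presheaf.stalk x)).presheaf.map (homOfLE (le_top :
        X.fromSpecStalk x ⁻¹ᵁ U ≤ ⊤)).op ≫ (Spec (X.presheaf.stalk x)).presheaf.map
          (homOfLE h1).op = 𝟙 _ := by
      rw [← Functor.map_comp]
      exact (Spec (X.presheaf.stalk x)).presheaf.map_id _
    rw [Scheme.Hom.appLE, Scheme.fromSpecStalk_app hx]
    simp only [Category.assoc]
    rw [h4, Category.comp_id]
  rw [← Scheme.Hom.appLE_comp_appLE (Spec.map ψ) (X.fromSpecStalk x) U ⊤ ⊤ h1 h2, h3,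
    Category.assoc, Scheme.ΓSpecIso_inv_naturality]
  congr 2

lemma le_preimage_SpecMap_comp_fromSpecStalk {R : CommRingCat.{u}} {x : X}
    (ψ : X.presheaf.stalk x ⟶ R) (U : X.Opens) (hx : x ∈ U) :
    ⊤ ≤ (Spec.map ψ ≫ X.fromSpecStalk x) ⁻¹ᵁ U := by
  intro y _
  have h : (Spec.map ψ ≫ X.fromSpecStalk x) y ⤳ x := by
    have : (Spec.map ψ ≫ X.fromSpecStalk x) y ∈ Set.range (X.fromSpecStalk x) :=
      ⟨Spec.map ψ y, rfl⟩
    rwa [Scheme.range_fromSpecStalk] at this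
  exact h.mem_open U.2 hx

/-- Supplies the test objects for the universal property: spectra of algebras over a stalk. -/
lemma isEffectiveCartier_comap_SpecMap {R : CommRingCat.{u}} {x : X}
    (ψ : X.presheaf.stalk x ⟶ R) (I : X.IdealSheafData) {f : R} (hf : f ∈ nonZeroDivisors R)
    (h : (stalkIdeal I x).map ψ.hom = Ideal.span {f}) :
    IsEffectiveCartier (I.comap (Spec.map ψ ≫ X.fromSpecStalk x)) := by
  intro y
  obtain ⟨U, hU⟩ := exists_affineOpen_mem x
  have hle := le_preimage_SpecMap_comp_fromSpecStalk ψ U.1 hU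
  refine ⟨⟨⊤, isAffineOpen_top _⟩, trivial, (Scheme.ΓSpecIso R).inv f, ?_, ?_⟩
  · rw [mem_nonZeroDivisors_iff_right]
    intro z hz
    have h1 := congrArg (Scheme.ΓSpecIso R).hom hz
    rw [map_mul, map_zero] at h1
    have h2 : (Scheme.ΓSpecIso R).hom z = 0 :=
      mem_nonZeroDivisors_iff_right.1 hf _ (by simpa using h1)
    have h3 := congrArg (Scheme.ΓSpecIso R).inv h2
    simpa using h3
  · rw [ideal_comap I _ U _ hle]
    erw [appLE_SpecMap_comp_fromSpecStalk ψ U.1 hU hle]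
    rw [CommRingCat.hom_comp, CommRingCat.hom_comp, ← Ideal.map_map, ← Ideal.map_map,
      ← stalkIdeal_eq I U hU, h, Ideal.map_span, Set.image_singleton]

/-- The map on stalks induced by `g` is a right inverse, up to the canonical identification of
stalks. -/
lemma surjective_stalkClosedPointTo {T X' : Scheme.{u}} {x' : X'}
    (φ : Spec (X'.presheaf.stalk x') ⟶ T) (g : T ⟶ X') (h : φ ≫ g = X'.fromSpecStalk x') :
    Function.Surjective (Scheme.stalkClosedPointTo φ) := by
  have key : ∀ f, f = X'.fromSpecStalk x' → Function.Surjective (Scheme.stalkClosedPointTo f) := by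
    rintro _ rfl
    rw [Scheme.stalkClosedPointTo_fromSpecStalk]
    exact (ConcreteCategory.bijective_of_isIso _).2
  have := key _ h
  rw [Scheme.stalkClosedPointTo_comp] at this
  intro z
  obtain ⟨y, hy⟩ := this z
  exact ⟨_, hy⟩

/-- The map from the stalk of `X` to the local ring at `τ` factors through the stalk at `x'`, where
`y` already vanishes. -/
lemma germ_SpecMap_comp_eq_zero {X' : Scheme.{u}} {σ : X' ⟶ X} {R : CommRingCat.{u}}
    (g : Spec R ⟶ X') (τ : Spec R) {x' : X'} (hτ : g τ = x')
    (ρ : X.presheaf.stalk (σ x') ⟶ R) (h : g ≫ σ = Spec.map ρ ≫ X.fromSpecStalk (σ x'))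
    {y : X.presheaf.stalk (σ x')} (hy : σ.stalkMap x' y = 0) :
    (Spec R).presheaf.germ ⊤ τ trivial ((Scheme.ΓSpecIso R).inv (ρ y)) = 0 := by
  obtain ⟨U, hU⟩ := exists_affineOpen_mem (σ x')
  obtain ⟨s, d, hd, e⟩ := exists_mul_germ_eq U hU y
  have h0 : X'.presheaf.germ (σ ⁻¹ᵁ U.1) x' hU (σ.app U.1 s) = 0 := by
    rw [← Scheme.Hom.germ_stalkMap_apply, ← e, map_mul, hy, zero_mul]
  have h1 : ∀ (z : X') (_ : z = x') (hz : z ∈ σ ⁻¹ᵁ U.1),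
      X'.presheaf.germ (σ ⁻¹ᵁ U.1) z hz (σ.app U.1 s) = 0 := by
    rintro _ rfl _; exact h0
  have hle := le_preimage_SpecMap_comp_fromSpecStalk ρ U.1 hU
  have h2 : (Spec R).presheaf.germ ⊤ τ trivial ((g ≫ σ).appLE U.1 ⊤ (h ▸ hle) s) = 0 := by
    have h4 := congrArg (g.stalkMap τ) (h1 (g τ) hτ (hτ ▸ hU))
    rw [map_zero, Scheme.Hom.germ_stalkMap_apply] at h4
    rw [← h4, Scheme.Hom.appLE, Scheme.Hom.comp_app]
    exact TopCat.Presheaf.germ_res_apply _ _ _ _ _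
  have h3 : (g ≫ σ).appLE U.1 ⊤ (h ▸ hle) s =
      (Scheme.ΓSpecIso R).inv (ρ (X.presheaf.germ U.1 _ hU s)) := by
    simp only [h]
    rw [appLE_SpecMap_comp_fromSpecStalk ρ U.1 hU hle]
    rfl
  rw [h3, ← e, map_mul, map_mul, map_mul] at h2
  refine (IsUnit.mul_left_eq_zero ?_).1 h2
  exact ((hd.map ρ.hom).map (Scheme.ΓSpecIso R).inv.hom).map
    ((Spec R).presheaf.germ ⊤ τ trivial).hom

lemma stalkClosedPointTo_SpecMap_apply {R S : CommRingCat.{u}} [IsLocalRing S] (ψ : R ⟶ S) (r : R) :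
    Scheme.stalkClosedPointTo (Spec.map ψ) ((Spec R).presheaf.germ ⊤ _ trivial
      ((Scheme.ΓSpecIso R).inv r)) = ψ r := by
  have := ConcreteCategory.congr_hom (Scheme.germ_stalkClosedPointTo_Spec ψ)
    ((Scheme.ΓSpecIso R).inv r)
  simpa using this

end Stalks

variable {X X' : Scheme.{u}}

lemma exists_inv_ΓSpecIso_eq {R : CommRingCat.{u}} (s : Γ(Spec R, ⊤)) :
    ∃ r : R, s = (Scheme.ΓSpecIso R).inv r := ⟨(Scheme.ΓSpecIso R).hom s, by simp⟩

/-- The local rings of a blow-up are localizations of affine blow-up algebras. -/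
theorem IsBlowUp.exists_isBlowUpChart {σ : X' ⟶ X} {Z : X.IdealSheafData} (hσ : IsBlowUp σ Z)
    (x' : X') : ∃ a, IsBlowUpChart (σ.stalkMap x').hom (stalkIdeal Z (σ x')) a := by
  obtain ⟨f, hf, hIf⟩ := hσ.isEffectiveCartier.exists_stalkIdeal_eq x'
  rw [stalkIdeal_comap] at hIf
  obtain ⟨a, ha, hanzd, haI⟩ := exists_mem_map_eq_span hf hIf
  set I := stalkIdeal Z (σ x') with hI
  obtain ⟨ψ, hψ⟩ := exists_affineBlowUp_lift ha (σ.stalkMap x').hom hanzd haI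
  let R : CommRingCat.{u} := .of (affineBlowUp I ha)
  let ρ : X.presheaf.stalk (σ x') ⟶ R := CommRingCat.ofHom (algebraMap (X.presheaf.stalk (σ x')) (affineBlowUp I ha))
  let ψ' : R ⟶ X'.presheaf.stalk x' := CommRingCat.ofHom ψ
  have hρψ : ρ ≫ ψ' = σ.stalkMap x' := by ext1; exact hψ
  -- The universal property gives `g : Spec O[I / a] ⟶ X'`; its uniqueness part below shows that `g`
  -- composed with `Spec` of the stalk at `x'` is the canonical morphism.
  obtain ⟨g, hg, -⟩ := hσ.existsUnique_lift (Spec.map ρ ≫ X.fromSpecStalk (σ x'))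
    (isEffectiveCartier_comap_SpecMap ρ Z (algebraMap_affineBlowUp_mem_nonZeroDivisors ha)
      (map_algebraMap_affineBlowUp ha))
  simp only at hg
  have hφg : Spec.map ψ' ≫ g = X'.fromSpecStalk x' := by
    refine (hσ.existsUnique_lift (Spec.map (σ.stalkMap x') ≫ X.fromSpecStalk (σ x'))
      (isEffectiveCartier_comap_SpecMap _ Z hanzd haI)).unique ?_ ?_
    · rw [Category.assoc, hg, ← Spec.map_comp_assoc, hρψ]
    · rw [Scheme.SpecMap_stalkMap_fromSpecStalk]
  set τ := Spec.map ψ' (IsLocalRing.closedPoint _) with hτdef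
  have hτ : g τ = x' := by
    exact (congrArg (fun f => f (IsLocalRing.closedPoint (X'.presheaf.stalk x'))) hφg).trans
      Scheme.fromSpecStalk_closedPoint
  have hunit (β : R) (hβ : IsUnit ((Spec R).presheaf.germ ⊤ τ trivial
      ((Scheme.ΓSpecIso R).inv β))) : IsUnit (ψ β) := by
    have := hβ.map (Scheme.stalkClosedPointTo (Spec.map ψ')).hom
    have e := stalkClosedPointTo_SpecMap_apply ψ' β
    erw [e] at this
    exact this
  have hψa (x : X.presheaf.stalk (σ x')) :
      ψ (algebraMap (X.presheaf.stalk (σ x')) (affineBlowUp I ha) x) = (σ.stalkMap x').hom x := by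
    rw [← hψ]; rfl
  refine ⟨a, ha, hanzd, haI, fun z => ?_, fun y hy => ?_⟩
  · obtain ⟨ζ, hζ⟩ := surjective_stalkClosedPointTo _ g hφg z
    obtain ⟨s, d, hd, e⟩ := exists_mul_germ_eq ⟨⊤, isAffineOpen_top (Spec R)⟩ trivial ζ
    obtain ⟨α, rfl⟩ := exists_inv_ΓSpecIso_eq s
    obtain ⟨β, rfl⟩ := exists_inv_ΓSpecIso_eq d
    have hβ := hunit β hd
    have h1 := congrArg (Scheme.stalkClosedPointTo (Spec.map ψ')) e
    rw [map_mul, hζ] at h1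
    erw [stalkClosedPointTo_SpecMap_apply, stalkClosedPointTo_SpecMap_apply] at h1
    have h2 : z * ψ β = ψ α := h1
    obtain ⟨n, y, hy, ey⟩ := affineBlowUp_exists ha α
    obtain ⟨m, c, hc, ec⟩ := affineBlowUp_exists ha β
    have ey' := congrArg ψ ey
    have ec' := congrArg ψ ec
    rw [map_mul, hψa, hψa, map_pow] at ey' ec'
    -- Here `α = y / a ^ n` and `β = c / a ^ m`; powers of `a` bring both to degree `n + m`.
    refine ⟨n + m, a ^ n * c, a ^ m * y, ⟨?_, hβ.unit, ?_⟩, ?_, ?_⟩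
    · rw [pow_add]; exact Ideal.mul_mem_mul (Ideal.pow_mem_pow ha _) hc
    · rw [map_mul, ← ec', map_pow, pow_add, IsUnit.unit_spec]; ring
    · rw [add_comm, pow_add]; exact Ideal.mul_mem_mul (Ideal.pow_mem_pow ha _) hy
    · rw [map_mul, map_mul, ← ec', ← ey', ← h2, map_pow, map_pow]; ring
  · have h1 := germ_SpecMap_comp_eq_zero g τ hτ ρ hg hy
    obtain ⟨d, hd, e⟩ := exists_mul_eq_zero_of_germ_eq_zero
      ⟨⊤, isAffineOpen_top (Spec R)⟩ trivial h1
    obtain ⟨β, rfl⟩ := exists_inv_ΓSpecIso_eq d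
    have hβ := hunit β hd
    have h2 : β * algebraMap (X.presheaf.stalk (σ x')) (affineBlowUp I ha) y = 0 := by
      have := congrArg (Scheme.ΓSpecIso R).hom e
      rw [map_mul, map_zero] at this
      rw [CategoryTheory.Iso.inv_hom_id_apply, CategoryTheory.Iso.inv_hom_id_apply] at this
      exact this
    obtain ⟨m, c, hc, ec⟩ := affineBlowUp_exists ha β
    have h3 : algebraMap (X.presheaf.stalk (σ x')) (affineBlowUp I ha) (c * y) = 0 := by
      rw [map_mul, ← ec, mul_assoc, h2, mul_zero]
    -- Vanishing in `O[1 / a]` costs a further power of `a`, absorbed into the denominator.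
    have h4 : algebraMap _ (Localization.Away a) (c * y) = 0 := congrArg Subtype.val h3
    rw [IsLocalization.map_eq_zero_iff (Submonoid.powers a)] at h4
    obtain ⟨⟨_, k, rfl⟩, hk⟩ := h4
    have ec' := congrArg ψ ec
    rw [map_mul, hψa, hψa, map_pow] at ec'
    refine ⟨k + m, a ^ k * c, ⟨?_, hβ.unit, ?_⟩, by rw [mul_assoc]; exact hk⟩
    · rw [pow_add]; exact Ideal.mul_mem_mul (Ideal.pow_mem_pow ha _) hc
    · rw [map_mul, ← ec', map_pow, pow_add, IsUnit.unit_spec]; ring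

end FamilyBlowUp

namespace FamilyBlowUp

variable {X Y W : Scheme.{u}}

/-! ### Equality of germs of divisors -/

section DivGerm

lemma divGerm_eq_iff {x : X} (a b : nonZeroDivisors (X.presheaf.stalk x)) :
    divGerm a = divGerm b ↔ ∃ c : (X.presheaf.stalk x)ˣ, (a : X.presheaf.stalk x) * c = b := by
  refine ⟨fun h => ?_, fun ⟨c, hc⟩ => divGerm_eq_of_associated a b c hc⟩
  have h' := Additive.ofMul.injective h
  rw [QuotientGroup.eq] at h'
  obtain ⟨c, hc⟩ := h'
  refine ⟨c, IsFractionRing.injective (X.presheaf.stalk x)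
    (FractionRing (X.presheaf.stalk x)) ?_⟩
  rw [eq_inv_mul_iff_mul_eq] at hc
  have := congrArg Units.val hc
  rw [map_mul]
  simpa using this

lemma divGerm_sub_eq_iff {x : X} (a b a' b' : nonZeroDivisors (X.presheaf.stalk x)) :
    divGerm a - divGerm b = divGerm a' - divGerm b' ↔ ∃ c : (X.presheaf.stalk x)ˣ,
      (a * b' : X.presheaf.stalk x) * c = a' * b := by
  rw [sub_eq_sub_iff_add_eq_add, ← divGerm_mul, ← divGerm_mul, divGerm_eq_iff]
  rfl

lemma divGerm_stalkMap_sub_eq (f : X ⟶ Y) {x : X}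
    {a b a' b' : nonZeroDivisors (Y.presheaf.stalk (f x))}
    (h : divGerm a - divGerm b = divGerm a' - divGerm b')
    (ha : (f.stalkMap x).hom a ∈ nonZeroDivisors (X.presheaf.stalk x))
    (hb : (f.stalkMap x).hom b ∈ nonZeroDivisors (X.presheaf.stalk x))
    (ha' : (f.stalkMap x).hom a' ∈ nonZeroDivisors (X.presheaf.stalk x))
    (hb' : (f.stalkMap x).hom b' ∈ nonZeroDivisors (X.presheaf.stalk x)) :
    divGerm ⟨_, ha⟩ - divGerm ⟨_, hb⟩ = divGerm ⟨_, ha'⟩ - divGerm ⟨_, hb'⟩ := by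
  rw [divGerm_sub_eq_iff] at h ⊢
  obtain ⟨c, hc⟩ := h
  refine ⟨Units.map (f.stalkMap x).hom.toMonoidHom c, ?_⟩
  have := congrArg (f.stalkMap x).hom hc
  simp only [map_mul] at this
  exact this

lemma divGerm_eq_of_span_singleton_eq {x : X} (a b : nonZeroDivisors (X.presheaf.stalk x))
    (h : Ideal.span {(a : X.presheaf.stalk x)} = Ideal.span {(b : X.presheaf.stalk x)}) :
    divGerm a = divGerm b := by
  obtain ⟨c, hc⟩ := Ideal.mem_span_singleton'.1 (h.le (Ideal.mem_span_singleton_self _))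
  obtain ⟨d, hd⟩ := Ideal.mem_span_singleton'.1 (h.ge (Ideal.mem_span_singleton_self _))
  have hcd : c * d = 1 := by
    refine (mul_cancel_right_mem_nonZeroDivisors a.2).1 ?_
    rw [mul_assoc, hd, hc, one_mul]
  exact divGerm_eq_of_associated a b ⟨d, c, by rw [mul_comm, hcd], hcd⟩ ((mul_comm _ _).trans hd)

lemma divGerm_eq_zero_of_isUnit {x : X} (a : nonZeroDivisors (X.presheaf.stalk x))
    (h : IsUnit (a : X.presheaf.stalk x)) : divGerm a = 0 := by
  have h1 : divGerm (1 : nonZeroDivisors (X.presheaf.stalk x)) = 0 := by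
    have := divGerm_mul (1 : nonZeroDivisors (X.presheaf.stalk x)) 1
    rwa [mul_one, left_eq_add] at this
  rw [← h1]
  refine divGerm_eq_of_span_singleton_eq _ _ ?_
  rw [Ideal.span_singleton_eq_top.2 h]
  exact (Ideal.span_singleton_eq_top.2 isUnit_one).symm

end DivGerm

/-! ### Pullback of Cartier divisors -/

section Pullback

/-- The morphism `f` pulls back non-zero-divisors to non-zero-divisors. -/
def PreservesNonZeroDivisors (f : X ⟶ Y) : Prop :=
  ∀ (x : X) (a : Y.presheaf.stalk (f x)), a ∈ nonZeroDivisors (Y.presheaf.stalk (f x)) →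
    (f.stalkMap x).hom a ∈ nonZeroDivisors (X.presheaf.stalk x)

lemma IsBlowUp.preservesNonZeroDivisors {σ : X ⟶ Y} {Z : Y.IdealSheafData} (h : IsBlowUp σ Z) :
    PreservesNonZeroDivisors σ := fun x _ ha =>
  (h.exists_isBlowUpChart x).choose_spec.map_nonZeroDivisors ha

namespace CartierDivisor

lemma IsPullbackOf.apply_eq {f : X ⟶ Y} {D : CartierDivisor Y} {D' : CartierDivisor X}
    (h : IsPullbackOf f D D') {x : X} {a b : nonZeroDivisors (Y.presheaf.stalk (f x))}
    (ha : (f.stalkMap x).hom a ∈ nonZeroDivisors (X.presheaf.stalk x))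
    (hb : (f.stalkMap x).hom b ∈ nonZeroDivisors (X.presheaf.stalk x))
    (e : D.1 (f x) = divGerm a - divGerm b) : D'.1 x = divGerm ⟨_, ha⟩ - divGerm ⟨_, hb⟩ := by
  obtain ⟨a', b', ha', hb', e', e''⟩ := h x
  rw [e'']
  exact divGerm_stalkMap_sub_eq f (e'.symm.trans e) ha' hb' ha hb

lemma IsPullbackOf.add {f : X ⟶ Y} {D E : CartierDivisor Y} {D' E' : CartierDivisor X}
    (hD : IsPullbackOf f D D') (hE : IsPullbackOf f E E') : IsPullbackOf f (D + E) (D' + E') := by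
  intro x
  obtain ⟨a, b, ha, hb, e, e'⟩ := hD x
  obtain ⟨c, d, hc, hd, k, k'⟩ := hE x
  have hac : (f.stalkMap x).hom (a * c : nonZeroDivisors _) ∈
      nonZeroDivisors (X.presheaf.stalk x) := by
    rw [Submonoid.coe_mul, map_mul]; exact mul_mem ha hc
  have hbd : (f.stalkMap x).hom (b * d : nonZeroDivisors _) ∈
      nonZeroDivisors (X.presheaf.stalk x) := by
    rw [Submonoid.coe_mul, map_mul]; exact mul_mem hb hd
  refine ⟨a * c, b * d, hac, hbd, ?_, ?_⟩
  · change D.1 (f x) + E.1 (f x) = _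
    rw [e, k, divGerm_mul, divGerm_mul]
    abel
  · change D'.1 x + E'.1 x = _
    have h1 : (⟨_, hac⟩ : nonZeroDivisors (X.presheaf.stalk x)) = ⟨_, ha⟩ * ⟨_, hc⟩ :=
      Subtype.ext (map_mul (f.stalkMap x).hom a.1 c.1)
    have h2 : (⟨_, hbd⟩ : nonZeroDivisors (X.presheaf.stalk x)) = ⟨_, hb⟩ * ⟨_, hd⟩ :=
      Subtype.ext (map_mul (f.stalkMap x).hom b.1 d.1)
    rw [e', k', h1, h2, divGerm_mul, divGerm_mul]
    abel

lemma IsPullbackOf.neg {f : X ⟶ Y} {D : CartierDivisor Y} {D' : CartierDivisor X}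
    (hD : IsPullbackOf f D D') : IsPullbackOf f (-D) (-D') := by
  intro x
  obtain ⟨a, b, ha, hb, e, e'⟩ := hD x
  refine ⟨b, a, hb, ha, ?_, ?_⟩
  · change -D.1 (f x) = _
    rw [e, neg_sub]
  · change -D'.1 x = _
    rw [e', neg_sub]

lemma IsPullbackOf.zero (f : X ⟶ Y) : IsPullbackOf f 0 0 := by
  intro x
  have h : (f.stalkMap x).hom (1 : nonZeroDivisors (Y.presheaf.stalk (f x))) ∈
      nonZeroDivisors (X.presheaf.stalk x) := by
    rw [Submonoid.coe_one, map_one]; exact one_mem _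
  exact ⟨1, 1, h, h, (sub_self _).symm, (sub_self _).symm⟩

lemma IsPullbackOf.nsmul {f : X ⟶ Y} {D : CartierDivisor Y} {D' : CartierDivisor X}
    (hD : IsPullbackOf f D D') (n : ℕ) : IsPullbackOf f (n • D) (n • D') := by
  induction n with
  | zero => rw [zero_smul, zero_smul]; exact IsPullbackOf.zero f
  | succ n ih => rw [succ_nsmul, succ_nsmul]; exact ih.add hD

lemma IsPullbackOf.zsmul {f : X ⟶ Y} {D : CartierDivisor Y} {D' : CartierDivisor X}
    (hD : IsPullbackOf f D D') (k : ℤ) : IsPullbackOf f (k • D) (k • D') := by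
  obtain ⟨n, rfl | rfl⟩ := k.eq_nat_or_neg
  · rw [natCast_zsmul, natCast_zsmul]; exact hD.nsmul n
  · rw [neg_smul, neg_smul, natCast_zsmul, natCast_zsmul]; exact (hD.nsmul n).neg

lemma IsPullbackOf.sub {f : X ⟶ Y} {D E : CartierDivisor Y} {D' E' : CartierDivisor X}
    (hD : IsPullbackOf f D D') (hE : IsPullbackOf f E E') : IsPullbackOf f (D - E) (D' - E') := by
  rw [sub_eq_add_neg, sub_eq_add_neg]
  exact hD.add hE.neg

lemma exists_isPullbackOf (f : X ⟶ Y) (D : CartierDivisor Y)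
    (h : ∀ x : X, ∃ (U : Y.Opens) (s t : Γ(Y, U)) (V : X.Opens) (hVU : V ≤ f ⁻¹ᵁ U), x ∈ V ∧
      IsLocallyDivOf D.1 U s t ∧ ∀ (y : X) (hy : y ∈ V),
        (f.stalkMap y).hom (Y.presheaf.germ U (f y) (hVU hy) s) ∈
          nonZeroDivisors (X.presheaf.stalk y) ∧
        (f.stalkMap y).hom (Y.presheaf.germ U (f y) (hVU hy) t) ∈
          nonZeroDivisors (X.presheaf.stalk y)) :
    ∃ D' : CartierDivisor X, IsPullbackOf f D D' := by
  have key (x : X) : ∃ (a b : nonZeroDivisors (Y.presheaf.stalk (f x)))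
      (_ : (f.stalkMap x).hom a ∈ nonZeroDivisors (X.presheaf.stalk x))
      (_ : (f.stalkMap x).hom b ∈ nonZeroDivisors (X.presheaf.stalk x)),
      D.1 (f x) = divGerm a - divGerm b := by
    obtain ⟨U, s, t, V, hVU, hx, hD, hV⟩ := h x
    obtain ⟨hs, ht, e⟩ := hD (f x) (hVU hx)
    exact ⟨⟨_, hs⟩, ⟨_, ht⟩, (hV x hx).1, (hV x hx).2, e⟩
  choose a b ha hb e using key
  refine ⟨⟨fun x => divGerm ⟨_, ha x⟩ - divGerm ⟨_, hb x⟩, fun x => ?_⟩,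
    fun x => ⟨a x, b x, ha x, hb x, e x, rfl⟩⟩
  obtain ⟨U, s, t, V, hVU, hx, hD, hV⟩ := h x
  refine ⟨V, hx, f.appLE U V hVU s, f.appLE U V hVU t, fun y hy => ?_⟩
  have hgerm (r : Γ(Y, U)) : X.presheaf.germ V y hy (f.appLE U V hVU r) =
      (f.stalkMap y).hom (Y.presheaf.germ U (f y) (hVU hy) r) := by
    rw [Scheme.Hom.appLE]
    refine (TopCat.Presheaf.germ_res_apply _ _ _ _ _).trans ?_
    exact (Scheme.Hom.germ_stalkMap_apply f U y (hVU hy) r).symm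
  simp only [hgerm]
  obtain ⟨hs, ht, e'⟩ := hD (f y) (hVU hy)
  refine ⟨(hV y hy).1, (hV y hy).2, ?_⟩
  -- The quotients chosen pointwise are unrelated to `s / t`, but both present `D` at `f y`, and the
  -- pullback does not depend on the presentation.
  exact divGerm_stalkMap_sub_eq f (a' := ⟨_, hs⟩) (b' := ⟨_, ht⟩) ((e y).symm.trans e')
    (ha y) (hb y) _ _

lemma exists_isPullbackOf_of_preservesNonZeroDivisors {f : X ⟶ Y}
    (hf : PreservesNonZeroDivisors f) (D : CartierDivisor Y) :
    ∃ D' : CartierDivisor X, IsPullbackOf f D D' := by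
  refine exists_isPullbackOf f D fun x => ?_
  obtain ⟨U, hx, s, t, h⟩ := D.2 (f x)
  refine ⟨U, s, t, f ⁻¹ᵁ U, le_rfl, hx, h, fun y hy => ?_⟩
  obtain ⟨hs, ht, -⟩ := h (f y) hy
  exact ⟨hf y _ hs, hf y _ ht⟩

lemma stalkMap_comp_apply (f : X ⟶ Y) (g : Y ⟶ W) (x : X) (a : W.presheaf.stalk (g (f x))) :
    ((f ≫ g).stalkMap x).hom a = (f.stalkMap x).hom ((g.stalkMap (f x)).hom a) := by
  rw [Scheme.Hom.stalkMap_comp]; rfl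

lemma IsPullbackOf.comp {f : X ⟶ Y} {g : Y ⟶ W} {D : CartierDivisor W} {D' : CartierDivisor Y}
    {D'' : CartierDivisor X} (h : IsPullbackOf g D D') (h' : IsPullbackOf f D' D'')
    (hf : PreservesNonZeroDivisors f) : IsPullbackOf (f ≫ g) D D'' := by
  intro x
  obtain ⟨a, b, ha, hb, e, e'⟩ := h (f x)
  have e'' := h'.apply_eq (a := ⟨_, ha⟩) (b := ⟨_, hb⟩) (hf _ _ ha) (hf _ _ hb) e'
  refine ⟨a, b, ?_, ?_, e, ?_⟩
  · exact (stalkMap_comp_apply f g x a).symm ▸ hf _ _ ha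
  · exact (stalkMap_comp_apply f g x b).symm ▸ hf _ _ hb
  · rw [e'']
    congr 3 <;> exact (stalkMap_comp_apply f g x _).symm

lemma IsPullbackOf.of_comp {f : X ⟶ Y} {g : Y ⟶ W} {D : CartierDivisor W} {D' : CartierDivisor Y}
    {D'' : CartierDivisor X} (h : IsPullbackOf (f ≫ g) D D'') (h' : IsPullbackOf g D D')
    (hg : PreservesNonZeroDivisors g) : IsPullbackOf f D' D'' := by
  intro x
  have key : ∃ (a b : nonZeroDivisors (W.presheaf.stalk (g (f x))))
      (ha : ((f ≫ g).stalkMap x).hom a.1 ∈ nonZeroDivisors (X.presheaf.stalk x))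
      (hb : ((f ≫ g).stalkMap x).hom b.1 ∈ nonZeroDivisors (X.presheaf.stalk x)),
      D.1 (g (f x)) = divGerm a - divGerm b ∧ D''.1 x = divGerm ⟨_, ha⟩ - divGerm ⟨_, hb⟩ := h x
  obtain ⟨a, b, ha, hb, e, e'⟩ := key
  have ha' := hg (f x) a a.2
  have hb' := hg (f x) b b.2
  have h1 := h'.apply_eq (x := f x) (a := a) (b := b) ha' hb' e
  have ha'' : (f.stalkMap x).hom ((g.stalkMap (f x)).hom a) ∈
      nonZeroDivisors (X.presheaf.stalk x) := by
    rw [← stalkMap_comp_apply]; exact ha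
  have hb'' : (f.stalkMap x).hom ((g.stalkMap (f x)).hom b) ∈
      nonZeroDivisors (X.presheaf.stalk x) := by
    rw [← stalkMap_comp_apply]; exact hb
  have ea : (⟨_, ha⟩ : nonZeroDivisors (X.presheaf.stalk x)) = ⟨_, ha''⟩ :=
    Subtype.ext (stalkMap_comp_apply f g x a)
  have eb : (⟨_, hb⟩ : nonZeroDivisors (X.presheaf.stalk x)) = ⟨_, hb''⟩ :=
    Subtype.ext (stalkMap_comp_apply f g x b)
  rw [ea, eb] at e'
  exact ⟨⟨_, ha'⟩, ⟨_, hb'⟩, ha'', hb'', h1, e'⟩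

end CartierDivisor

lemma stalkIdeal_eq_span (I : X.IdealSheafData) (U : X.affineOpens) {x : X} (hx : x ∈ U.1)
    (f : Γ(X, U.1)) (h : I.ideal U = Ideal.span {f}) :
    stalkIdeal I x = Ideal.span {X.presheaf.germ U.1 x hx f} := by
  rw [stalkIdeal_eq I U hx, h, Ideal.map_span, Set.image_singleton]

lemma IsEffectiveCartier.toCartierDivisor_apply {I : X.IdealSheafData}
    (hI : IsEffectiveCartier I) {x : X} (f : nonZeroDivisors (X.presheaf.stalk x))
    (h : stalkIdeal I x = Ideal.span {(f : X.presheaf.stalk x)}) :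
    hI.toCartierDivisor.1 x = divGerm f := by
  refine divGerm_eq_of_span_singleton_eq _ _ ?_
  exact (stalkIdeal_eq_span I _ (hI x).choose_spec.1 _
    (hI x).choose_spec.2.choose_spec.2).symm.trans h

/-- The pulled back generator divides a non-zero-divisor generator of `J`, so it is itself a
non-zero-divisor. -/
lemma IsEffectiveCartier.isPullbackOf {I : Y.IdealSheafData} {J : X.IdealSheafData} (f : X ⟶ Y)
    (hI : IsEffectiveCartier I) (hJ : IsEffectiveCartier J) (h : I.comap f = J) :
    CartierDivisor.IsPullbackOf f hI.toCartierDivisor hJ.toCartierDivisor := by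
  intro x
  obtain ⟨a, ha, e⟩ := hI.exists_stalkIdeal_eq (f x)
  obtain ⟨b, hb, e'⟩ := hJ.exists_stalkIdeal_eq x
  have h1 := stalkIdeal_comap I f x
  rw [h, e, Ideal.map_span, Set.image_singleton] at h1
  have h2 : (f.stalkMap x).hom a ∈ nonZeroDivisors (X.presheaf.stalk x) := by
    obtain ⟨c, hc⟩ := Ideal.mem_span_singleton'.1
      ((e'.symm.trans h1).le (Ideal.mem_span_singleton_self b))
    rw [← hc, mul_mem_nonZeroDivisors] at hb
    exact hb.2
  have h3 : (f.stalkMap x).hom (1 : nonZeroDivisors (Y.presheaf.stalk (f x))) ∈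
      nonZeroDivisors (X.presheaf.stalk x) := by
    rw [Submonoid.coe_one, map_one]; exact one_mem _
  refine ⟨⟨a, ha⟩, 1, h2, h3, ?_, ?_⟩
  · rw [hI.toCartierDivisor_apply ⟨a, ha⟩ e, divGerm_eq_zero_of_isUnit 1 isUnit_one, sub_zero]
  · rw [hJ.toCartierDivisor_apply ⟨_, h2⟩ h1, divGerm_eq_zero_of_isUnit ⟨_, h3⟩ (by simp),
      sub_zero]

end Pullback

/-! ### Spreading out from germs, and supports of divisors -/

section Support

lemma IsLocallyDivOf.res {D : ∀ x : X, DivisorGerm X x} {U V : X.Opens} {s t : Γ(X, U)}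
    (h : IsLocallyDivOf D U s t) (hVU : V ≤ U) :
    IsLocallyDivOf D V (X.presheaf.map (homOfLE hVU).op s) (X.presheaf.map (homOfLE hVU).op t) := by
  intro y hy
  simp only [TopCat.Presheaf.germ_res_apply]
  exact h y (hVU hy)

lemma CartierDivisor.exists_affineOpen (D : CartierDivisor X) (x : X) :
    ∃ U : X.affineOpens, x ∈ U.1 ∧ ∃ s t : Γ(X, U.1), IsLocallyDivOf D.1 U.1 s t := by
  obtain ⟨U, hx, s, t, h⟩ := D.2 x
  obtain ⟨V, hxV, hVU⟩ := exists_affineOpen_mem_le hx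
  exact ⟨V, hxV, _, _, h.res hVU⟩

/-- If two sections agree up to a unit in the local ring at `x`, then they do so near `x`. -/
lemma exists_mul_eq_mul_of_germ_mul_unit_eq (U : X.affineOpens) {x : X} (hx : x ∈ U.1)
    {s t : Γ(X, U.1)} (c : (X.presheaf.stalk x)ˣ)
    (h : X.presheaf.germ U.1 x hx s * c = X.presheaf.germ U.1 x hx t) :
    ∃ d e : Γ(X, U.1), IsUnit (X.presheaf.germ U.1 x hx d) ∧ IsUnit (X.presheaf.germ U.1 x hx e) ∧
      s * d = t * e := by
  obtain ⟨p, q, hq, e⟩ := exists_mul_germ_eq U hx (c : X.presheaf.stalk x)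
  have hp : IsUnit (X.presheaf.germ U.1 x hx p) := e ▸ c.isUnit.mul hq
  have h1 : X.presheaf.germ U.1 x hx (s * p - t * q) = 0 := by
    rw [map_sub, map_mul, map_mul, ← e, ← h]; ring
  obtain ⟨k, hk, hk'⟩ := exists_mul_eq_zero_of_germ_eq_zero U hx h1
  refine ⟨k * p, k * q, ?_, ?_, by linear_combination hk'⟩
  · rw [map_mul]; exact hk.mul hp
  · rw [map_mul]; exact hk.mul hq

lemma CartierDivisor.isClosed_support (D : CartierDivisor X) : IsClosed (CartierDivisor.support D) := by
  rw [← isOpen_compl_iff, isOpen_iff_forall_mem_open]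
  intro x hx
  have hx : D.1 x = 0 := not_not.1 hx
  obtain ⟨U, hxU, s, t, h⟩ := CartierDivisor.exists_affineOpen D x
  obtain ⟨hs, ht, e⟩ := h x hxU
  rw [hx, eq_comm, sub_eq_zero, divGerm_eq_iff] at e
  obtain ⟨c, hc⟩ := e
  obtain ⟨d, e, hd, he, hde⟩ := exists_mul_eq_mul_of_germ_mul_unit_eq U hxU c hc
  refine ⟨X.basicOpen d ⊓ X.basicOpen e, fun y hy => ?_, (X.basicOpen d ⊓ X.basicOpen e).2,
    ⟨(Scheme.mem_basicOpen _ _ _ hxU).2 hd, (Scheme.mem_basicOpen _ _ _ hxU).2 he⟩⟩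
  have hyU : y ∈ U.1 := X.basicOpen_le d hy.1
  have hd' := (Scheme.mem_basicOpen _ _ _ hyU).1 hy.1
  have he' := (Scheme.mem_basicOpen _ _ _ hyU).1 hy.2
  obtain ⟨hs', ht', e'⟩ := h y hyU
  refine not_not.2 ?_
  rw [e', sub_eq_zero, divGerm_eq_iff]
  refine ⟨hd'.unit * he'.unit⁻¹, ?_⟩
  have h2 := congrArg (X.presheaf.germ U.1 y hyU) hde
  rw [map_mul, map_mul] at h2
  rw [Units.val_mul, ← mul_assoc, Units.mul_inv_eq_iff_eq_mul]
  exact h2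

/-- On a locally Noetherian scheme, being a non-zero-divisor is an open condition. -/
lemma exists_basicOpen_germ_mem_nonZeroDivisors [IsLocallyNoetherian X] (U : X.affineOpens) {x : X}
    (hx : x ∈ U.1) (s : Γ(X, U.1))
    (hs : X.presheaf.germ U.1 x hx s ∈ nonZeroDivisors (X.presheaf.stalk x)) :
    ∃ d : Γ(X, U.1), x ∈ X.basicOpen d ∧ ∀ (y : X) (hy : y ∈ U.1), y ∈ X.basicOpen d →
      X.presheaf.germ U.1 y hy s ∈ nonZeroDivisors (X.presheaf.stalk y) := by
  classical
  have : IsNoetherianRing Γ(X, U.1) := IsLocallyNoetherian.component_noetherian U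
  -- The annihilator of `s` is finitely generated and vanishes in the stalk at `x`, so a single `d`
  -- that is a unit at `x` kills it.
  obtain ⟨G, hG⟩ := IsNoetherian.noetherian ((⊥ : Ideal Γ(X, U.1)).colon {s})
  have h1 (g : Γ(X, U.1)) (hg : g ∈ G) :
      ∃ d : Γ(X, U.1), IsUnit (X.presheaf.germ U.1 x hx d) ∧ d * g = 0 := by
    refine exists_mul_eq_zero_of_germ_eq_zero U hx ?_
    have h2 : g ∈ (⊥ : Ideal Γ(X, U.1)).colon {s} := hG ▸ Ideal.subset_span hg
    rw [Submodule.mem_colon_singleton, smul_eq_mul, Ideal.mem_bot] at h2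
    have h3 := congrArg (X.presheaf.germ U.1 x hx) h2
    rw [map_mul, map_zero] at h3
    exact mem_nonZeroDivisors_iff_right.1 hs _ h3
  choose! d hd hd' using h1
  refine ⟨∏ g ∈ G, d g, (Scheme.mem_basicOpen _ _ _ hx).2 ?_, fun y hy hyd => ?_⟩
  · rw [map_prod]
    exact Finset.prod_induction _ IsUnit (fun _ _ => IsUnit.mul) isUnit_one hd
  · have hkill : ∀ z ∈ (⊥ : Ideal Γ(X, U.1)).colon {s}, (∏ g ∈ G, d g) * z = 0 := by
      intro z hz
      rw [← hG] at hz
      have hle : Ideal.span (G : Set Γ(X, U.1)) ≤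
          (⊥ : Ideal Γ(X, U.1)).colon {∏ g ∈ G, d g} := by
        rw [Ideal.span_le]
        intro g hg
        refine Submodule.mem_colon_singleton.2 ?_
        rw [smul_eq_mul, Ideal.mem_bot, mul_comm, ← Finset.prod_erase_mul _ _ hg, mul_assoc,
          hd' g hg, mul_zero]
      have := Submodule.mem_colon_singleton.1 (hle hz)
      rwa [smul_eq_mul, Ideal.mem_bot, mul_comm] at this
    have hyd' := (Scheme.mem_basicOpen _ _ _ hy).1 hyd
    rw [mem_nonZeroDivisors_iff_right]
    intro z hz
    obtain ⟨w, e, he, h2⟩ := exists_mul_germ_eq U hy z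
    have h3 : X.presheaf.germ U.1 y hy (w * s) = 0 := by
      rw [map_mul, ← h2, mul_right_comm, hz, zero_mul]
    obtain ⟨c, hc, h4⟩ := exists_mul_eq_zero_of_germ_eq_zero U hy h3
    have h5 := hkill (c * w) (by
      rw [Submodule.mem_colon_singleton, smul_eq_mul, Ideal.mem_bot, mul_assoc, h4])
    have h6 := congrArg (X.presheaf.germ U.1 y hy) h5
    rw [map_mul, map_mul, map_zero, hyd'.mul_right_eq_zero, hc.mul_right_eq_zero, ← h2,
      he.mul_left_eq_zero] at h6
    exact h6

end Support

end FamilyBlowUp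

namespace FamilyBlowUp

/-- Having no proper generization in `S`, the point `η` is generic in its component of `S`; if it
lay in the closed set `T`, so would the whole component. -/
lemma HasNoComponentIn.notMem_of_forall_specializes {α : Type*} [TopologicalSpace α] [QuasiSober α]
    [T0Space α] {S T : Set α} (h : HasNoComponentIn S T) (hS : IsClosed S) (hT : IsClosed T) {η : α}
    (hη : η ∈ S) (hmin : ∀ ζ ∈ S, ζ ⤳ η → ζ = η) : η ∉ T := by
  intro hηT
  let C := irreducibleComponent (⟨η, hη⟩ : S)
  refine h C (irreducibleComponent_mem_irreducibleComponents _) ?_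
  have : QuasiSober S := hS.isClosedEmbedding_subtypeVal.quasiSober
  have hirr : IsIrreducible C := isIrreducible_irreducibleComponent
  have hcl : IsClosed C := isClosed_irreducibleComponent
  have hgen := hirr.isGenericPoint_genericPoint hcl
  have h1 := hgen.specializes (mem_irreducibleComponent (x := (⟨η, hη⟩ : S)))
  have h2 := hmin _ (hirr.genericPoint).2 (h1.map continuous_subtype_val)
  rintro _ ⟨y, hy, rfl⟩
  have h3 := (hgen.specializes hy).map continuous_subtype_val
  rw [h2] at h3
  exact h3.mem_closed hT hηT

variable {X Y : Scheme.{u}}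

/-! ### Primes of a local ring as generizations -/

section Points

/-- The generization of `x` given by a prime of its local ring. -/
noncomputable def primePoint (x : X) (p : Ideal (X.presheaf.stalk x)) [hp : p.IsPrime] : X :=
  X.fromSpecStalk x (⟨p, hp⟩ : PrimeSpectrum (X.presheaf.stalk x))

variable (x : X) (p : Ideal (X.presheaf.stalk x)) [hp : p.IsPrime]

lemma primePoint_specializes : primePoint x p ⤳ x := by
  have : primePoint x p ∈ Set.range (X.fromSpecStalk x) := ⟨_, rfl⟩
  rwa [Scheme.range_fromSpecStalk] at this

lemma primePoint_mem (U : X.Opens) (hx : x ∈ U) : primePoint x p ∈ U :=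
  (primePoint_specializes x p).mem_open U.2 hx

lemma exists_eq_primePoint {x y : X} (h : y ⤳ x) :
    ∃ (p : Ideal (X.presheaf.stalk x)) (_ : p.IsPrime), y = primePoint x p := by
  have : y ∈ Set.range (X.fromSpecStalk x) := by rwa [Scheme.range_fromSpecStalk]
  obtain ⟨p, rfl⟩ := this
  exact ⟨p.asIdeal, p.isPrime, rfl⟩

lemma le_of_primePoint_specializes (q : Ideal (X.presheaf.stalk x)) [hq : q.IsPrime]
    (h : primePoint x q ⤳ primePoint x p) : q ≤ p := by
  have h1 := (X.fromSpecStalk x).isEmbedding.isInducing.specializes_iff.1 h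
  exact (PrimeSpectrum.le_iff_specializes (⟨q, hq⟩ : PrimeSpectrum (X.presheaf.stalk x))
    ⟨p, hp⟩).2 h1

lemma primePoint_mem_basicOpen_iff (U : X.Opens) (hx : x ∈ U) (s : Γ(X, U)) :
    primePoint x p ∈ X.basicOpen s ↔ X.presheaf.germ U x hx s ∉ p := by
  have h1 : X.fromSpecStalk x ⁻¹ᵁ X.basicOpen s =
      PrimeSpectrum.basicOpen (X.presheaf.germ U x hx s) := by
    have h2 : X.fromSpecStalk x ⁻¹ᵁ U = ⊤ := top_le_iff.1 fun q _ =>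
      have := q.isPrime
      primePoint_mem x q.asIdeal U hx
    rw [Scheme.preimage_basicOpen, Scheme.fromSpecStalk_app hx]
    refine (Scheme.basicOpen_res _ _ _).trans ?_
    rw [h2, top_inf_eq]
    exact (basicOpen_eq_of_affine _)
  change (⟨p, hp⟩ : PrimeSpectrum (X.presheaf.stalk x)) ∈ X.fromSpecStalk x ⁻¹ᵁ X.basicOpen s ↔ _
  rw [h1]
  rfl

lemma isUnit_germ_primePoint_iff (U : X.Opens) (hx : x ∈ U) (hp : primePoint x p ∈ U)
    (s : Γ(X, U)) :
    IsUnit (X.presheaf.germ U (primePoint x p) hp s) ↔ X.presheaf.germ U x hx s ∉ p := by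
  rw [← primePoint_mem_basicOpen_iff x p U hx s, Scheme.mem_basicOpen _ _ _ hp]

lemma primePoint_mem_support_iff (I : X.IdealSheafData) :
    primePoint x p ∈ I.support ↔ stalkIdeal I x ≤ p := by
  obtain ⟨U, hU⟩ := exists_affineOpen_mem x
  rw [Scheme.IdealSheafData.mem_support_iff_of_mem (primePoint_mem x p U.1 hU), stalkIdeal_eq I U hU,
    Ideal.map_le_iff_le_comap, Scheme.mem_zeroLocus_iff]
  refine forall₂_congr fun f hf => ?_
  rw [primePoint_mem_basicOpen_iff x p U.1 hU, not_not]
  rfl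

lemma isRadical_ideal (I : X.IdealSheafData) [AlgebraicGeometry.IsReduced I.subscheme]
    (U : X.affineOpens) : (I.ideal U).IsRadical := by
  rw [← I.ker_subschemeι_app U]
  rintro a ⟨n, hn⟩
  rw [RingHom.mem_ker, map_pow] at hn
  exact eq_zero_of_pow_eq_zero hn

lemma isRadical_stalkIdeal (I : X.IdealSheafData) [AlgebraicGeometry.IsReduced I.subscheme] :
    (stalkIdeal I x).IsRadical := by
  obtain ⟨U, hU⟩ := exists_affineOpen_mem x
  rintro a ⟨n, hn⟩
  rw [stalkIdeal_eq I U hU] at hn ⊢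
  obtain ⟨s, d, hd, e⟩ := exists_mul_germ_eq U hU a
  refine (Ideal.mul_unit_mem_iff_mem _ hd).1 ?_
  have h2 := Ideal.mul_mem_right (X.presheaf.germ U.1 x hU d ^ n) _ hn
  rw [← mul_pow, e, ← map_pow] at h2
  obtain ⟨k, hk, hk'⟩ := exists_mul_mem_of_germ_mem U hU h2
  have h3 : k * s ∈ I.ideal U := by
    refine isRadical_ideal I U ⟨n + 1, ?_⟩
    have : (k * s) ^ (n + 1) = k ^ n * s * (k * s ^ n) := by ring
    rw [this]
    exact Ideal.mul_mem_left _ _ hk'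
  rw [e]
  refine (Ideal.unit_mul_mem_iff_mem _ hk).1 ?_
  rw [← map_mul]
  exact Ideal.mem_map_of_mem _ h3

/-- A closed subscheme without irreducible component in `T`: a function cutting out points of `T`
is a non-zero-divisor on it. -/
lemma mem_stalkIdeal_of_mul_mem (Z : X.IdealSheafData) [AlgebraicGeometry.IsReduced Z.subscheme]
    {T : Set X} (hT : IsClosed T) (h : HasNoComponentIn (Z.support : Set X) T)
    {t : X.presheaf.stalk x}
    (ht : ∀ (p : Ideal (X.presheaf.stalk x)) [p.IsPrime], t ∈ p → primePoint x p ∈ T)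
    {y : X.presheaf.stalk x} (hy : t * y ∈ stalkIdeal Z x) : y ∈ stalkIdeal Z x := by
  refine mem_of_mul_mem_of_forall_notMem_minimalPrimes (isRadical_stalkIdeal x Z)
    (fun p hp htp => ?_) hy
  have := hp.1.1
  refine h.notMem_of_forall_specializes Z.support.isClosed hT
    ((primePoint_mem_support_iff x p Z).2 hp.1.2) (fun ζ hζ hspec => ?_) (ht p htp)
  obtain ⟨q, _, rfl⟩ := exists_eq_primePoint (hspec.trans (primePoint_specializes x p))
  have hqp := le_of_primePoint_specializes x p q hspec
  have hpq := hp.2 ⟨‹_›, (primePoint_mem_support_iff x q Z).1 hζ⟩ hqp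
  obtain rfl := le_antisymm hqp hpq
  rfl

end Points

/-! ### Normal flatness of both types of centers -/

section Centers

lemma IsRegularlyImmersed.isNormallyFlat {Z : X.IdealSheafData} (hZ : IsRegularlyImmersed Z)
    (x : X) : IsNormallyFlat (stalkIdeal Z x) := by
  by_cases hx : x ∈ Z.support
  · obtain ⟨U, hU, rs, hrs, e⟩ := hZ x hx
    rw [stalkIdeal_eq Z U hU, e]
    let _ := TopCat.Presheaf.algebra_section_stalk X.presheaf (⟨x, hU⟩ : U.1)
    have := U.2.isLocalization_stalk ⟨x, hU⟩
    exact (isNormallyFlat_ofList rs hrs.toIsWeaklyRegular).map_isLocalization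
      (U.2.primeIdealOf ⟨x, hU⟩).asIdeal.primeCompl (B := X.presheaf.stalk x)
  · rw [mem_support_iff_stalkIdeal_ne_top, not_not] at hx
    rw [hx]
    exact isNormallyFlat_top

/-- Needed because the opens carrying the regular sequences of `W` need not be those carrying the
equation of the double cover. -/
lemma isNormallyFlat_ideal_of_forall_stalkIdeal {Z : X.IdealSheafData}
    (h : ∀ x, IsNormallyFlat (stalkIdeal Z x)) (U : X.affineOpens) :
    IsNormallyFlat (Z.ideal U) := by
  refine isNormallyFlat_of_forall_isMaximal fun P hP => ?_
  let y : PrimeSpectrum Γ(X, U.1) := ⟨P, hP.isPrime⟩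
  have hy : U.2.fromSpec y ∈ U.1 := (U.2.isoSpec.inv y).2
  have := h (U.2.fromSpec y)
  rw [stalkIdeal_eq Z U hy] at this
  exact ⟨X.presheaf.stalk (U.2.fromSpec y), inferInstance,
    TopCat.Presheaf.algebra_section_stalk X.presheaf ⟨_, hy⟩, U.2.isLocalization_stalk' y hy, this⟩

lemma IsNormallyFlat.stalkIdeal {Z : X.IdealSheafData} {U : X.affineOpens} {x : X} (hU : x ∈ U.1)
    (h : IsNormallyFlat (Z.ideal U)) : IsNormallyFlat (stalkIdeal Z x) := by
  rw [stalkIdeal_eq Z U hU]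
  let _ := TopCat.Presheaf.algebra_section_stalk X.presheaf (⟨x, hU⟩ : U.1)
  have := U.2.isLocalization_stalk ⟨x, hU⟩
  exact h.map_isLocalization
    (U.2.primeIdealOf ⟨x, hU⟩).asIdeal.primeCompl (B := X.presheaf.stalk x)

lemma IsDoubleCoverCenter.isNormallyFlat {Z : X.IdealSheafData} (hZ : IsDoubleCoverCenter Z)
    (x : X) : IsNormallyFlat (stalkIdeal Z x) := by
  obtain ⟨V, p, D, W, hp, hWred, hW, hDW, rfl⟩ := hZ
  obtain ⟨U, hU, -, F, -, hF, w, hw, huniq⟩ := hp.local_eq (p x)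
  have := hp.isAffineHom
  let U' : X.affineOpens := ⟨p ⁻¹ᵁ U.1, U.2.preimage p⟩
  refine IsNormallyFlat.stalkIdeal (U := U') hU ?_
  have hJ := isNormallyFlat_ideal_of_forall_stalkIdeal hW.isNormallyFlat U
  have hFJ : F ∈ W.ideal U ^ 2 := by
    have := hDW U
    rw [hF, Ideal.span_singleton_le_iff_mem] at this
    exact this
  have e : ((W.comap p).radical).ideal U' = ((W.ideal U).map (p.app U.1).hom).radical := by
    change ((W.comap p).ideal U').radical = _
    rw [ideal_comap W p U U' le_rfl, Scheme.Hom.app_eq_appLE]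
  rw [e, radical_map_eq_sup_span hw huniq hFJ (isRadical_ideal W U)]
  exact hJ.map_sup_span hw huniq hFJ

end Centers

/-! ### Local equation of the fiber -/

section Fiber

variable {B : Scheme.{u}}

lemma isClosedImmersion_fromSpecResidueField {b : B} (hb : IsClosed ({b} : Set B)) :
    IsClosedImmersion (B.fromSpecResidueField b) :=
  .of_isPreimmersion _ (by rw [Scheme.range_fromSpecResidueField]; exact hb)

lemma isClosedImmersion_fiberι (π : X ⟶ B) {b : B} (hb : IsClosed ({b} : Set B)) :
    IsClosedImmersion (π.fiberι b) := by
  have := isClosedImmersion_fromSpecResidueField hb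
  exact inferInstanceAs (IsClosedImmersion (pullback.fst π (B.fromSpecResidueField b)))

/-- Germs on the spectrum of a field are zero or units, and the stalk map is local, so its kernel
consists exactly of the non-units. -/
lemma stalkIdeal_ker_fromSpecResidueField {b : B} (hb : IsClosed ({b} : Set B)) :
    stalkIdeal (B.fromSpecResidueField b).ker b =
      IsLocalRing.maximalIdeal (B.presheaf.stalk b) := by
  have := isClosedImmersion_fromSpecResidueField hb
  obtain ⟨z, hz⟩ : ∃ z, B.fromSpecResidueField b z = b := by
    have : b ∈ Set.range (B.fromSpecResidueField b) := by
      rw [Scheme.range_fromSpecResidueField]; rfl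
    exact this
  have key : ∀ y, B.fromSpecResidueField b z = y → stalkIdeal (B.fromSpecResidueField b).ker y =
      IsLocalRing.maximalIdeal (B.presheaf.stalk y) := by
    rintro _ rfl
    rw [← ker_stalkMap]
    ext a
    rw [RingHom.mem_ker, IsLocalRing.mem_maximalIdeal, mem_nonunits_iff,
      ← isUnit_map_iff ((B.fromSpecResidueField b).stalkMap z).hom a]
    obtain ⟨s, d, hd, e⟩ := exists_mul_germ_eq ⟨⊤, isAffineOpen_top _⟩ (x := z) trivial
      (((B.fromSpecResidueField b).stalkMap z).hom a)
    obtain ⟨k, rfl⟩ := exists_inv_ΓSpecIso_eq s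
    rcases eq_or_ne k 0 with rfl | hk
    · rw [map_zero, map_zero, hd.mul_left_eq_zero] at e
      rw [e]
      exact iff_of_true rfl not_isUnit_zero
    · have h1 := ((isUnit_iff_ne_zero.2 hk).map (Scheme.ΓSpecIso _).inv.hom).map
        ((Spec (B.residueField b)).presheaf.germ ⊤ z trivial).hom
      have h2 := isUnit_of_mul_isUnit_left (e.symm ▸ h1)
      exact iff_of_false h2.ne_zero (not_not.2 h2)
  exact key b hz

lemma stalkIdeal_ker_fiberι (π : X ⟶ B) (x : X) (hb : IsClosed ({π x} : Set B)) :
    stalkIdeal (π.fiberι (π x)).ker x =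
      (IsLocalRing.maximalIdeal (B.presheaf.stalk (π x))).map (π.stalkMap x).hom := by
  have := isClosedImmersion_fromSpecResidueField hb
  have h1 : (π.fiberι (π x)).ker = (B.fromSpecResidueField (π x)).ker.comap π :=
    Scheme.IdealSheafData.ker_fst_of_isClosedImmersion _ _
  rw [h1, stalkIdeal_comap, stalkIdeal_ker_fromSpecResidueField hb]

/-- A local equation of the fiber of a flat family over a closed point whose local ring is a
discrete valuation ring. -/
lemma exists_stalkIdeal_ker_fiberι_eq (π : X ⟶ B) [Flat π] (b : B) (hb : IsClosed ({b} : Set B))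
    [IsDomain (B.presheaf.stalk b)] [IsDiscreteValuationRing (B.presheaf.stalk b)] (x : X)
    (hx : π x = b) :
    ∃ t ∈ nonZeroDivisors (X.presheaf.stalk x),
      stalkIdeal (π.fiberι b).ker x = Ideal.span {t} := by
  subst hx
  obtain ⟨ϖ, hϖ⟩ := IsDiscreteValuationRing.exists_irreducible (B.presheaf.stalk (π x))
  refine ⟨(π.stalkMap x).hom ϖ, ?_, ?_⟩
  · have hflat := Flat.stalkMap π x
    algebraize [(π.stalkMap x).hom]
    have := Module.Flat.isSMulRegular_of_nonZeroDivisors (M := X.presheaf.stalk x)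
      (mem_nonZeroDivisors_of_ne_zero hϖ.ne_zero)
    rw [mem_nonZeroDivisors_iff_left]
    intro z hz
    refine this.right_eq_zero_of_smul ?_
    rw [Algebra.smul_def]
    exact hz
  · rw [stalkIdeal_ker_fiberι π x hb, hϖ.maximalIdeal_eq, Ideal.map_span, Set.image_singleton]

lemma support_ker_fiberι (π : X ⟶ B) {b : B} (hb : IsClosed ({b} : Set B)) :
    ((π.fiberι b).ker.support : Set X) = π ⁻¹' {b} := by
  have := isClosedImmersion_fiberι π hb
  rw [Scheme.Hom.support_ker, Scheme.Hom.range_fiberι]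
  exact (hb.preimage π.continuous).closure_eq

lemma apply_fiberι (π : X ⟶ B) (b : B) (x : π.fiber b) : π (π.fiberι b x) = b := by
  have : π.fiberι b x ∈ Set.range (π.fiberι b) := ⟨x, rfl⟩
  rwa [Scheme.Hom.range_fiberι] at this

end Fiber

end FamilyBlowUp

/-! ### Restriction of the blow-up to the fiber -/

namespace FamilyBlowUp

variable {X Y : Scheme.{u}}

lemma isEffectiveCartier_comap_of_forall_mem (j : Y ⟶ X) [IsClosedImmersion j]
    {I : X.IdealSheafData} (hI : IsEffectiveCartier I)
    (h : ∀ (y : Y) (f : X.presheaf.stalk (j y)), stalkIdeal I (j y) = Ideal.span {f} →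
      ∀ v, f * v ∈ stalkIdeal j.ker (j y) → v ∈ stalkIdeal j.ker (j y)) :
    IsEffectiveCartier (I.comap j) := by
  intro y
  obtain ⟨W, hW, f, -, hf⟩ := hI (j y)
  let V : Y.affineOpens := ⟨j ⁻¹ᵁ W.1, W.2.preimage j⟩
  refine ⟨V, hW, (j.appLE W.1 V.1 le_rfl).hom f, ?_, ?_⟩
  · refine mem_nonZeroDivisors_of_germ V.1 _ fun z hz => ?_
    have e : Y.presheaf.germ V.1 z hz ((j.appLE W.1 V.1 le_rfl).hom f) =
        (j.stalkMap z).hom (X.presheaf.germ W.1 (j z) hz f) := by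
      rw [← Scheme.Hom.app_eq_appLE]
      exact (Scheme.Hom.germ_stalkMap_apply j W.1 z hz f).symm
    rw [e, mem_nonZeroDivisors_iff_left]
    intro v hv
    obtain ⟨v, rfl⟩ := j.stalkMap_surjective z v
    have h1 := h z _ (stalkIdeal_eq_span I W hz f hf) v
    rw [← ker_stalkMap, RingHom.mem_ker, RingHom.mem_ker, map_mul] at h1
    exact h1 hv
  · rw [ideal_comap I j W V le_rfl, hf, Ideal.map_span, Set.image_singleton]

/-- A test morphism to `Y` is also one to `X`, so it lifts uniquely to `X'` and hence to the fiber
product. Only the Cartier condition is not formal. -/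
lemma IsBlowUp.pullback_snd {X' : Scheme.{u}} {σ : X' ⟶ X} {Z : X.IdealSheafData}
    (hσ : IsBlowUp σ Z) (i : Y ⟶ X)
    (h : IsEffectiveCartier ((Z.comap i).comap (pullback.snd σ i))) :
    IsBlowUp (pullback.snd σ i) (Z.comap i) where
  isEffectiveCartier := h
  existsUnique_lift {W} f hf := by
    rw [← Scheme.IdealSheafData.comap_comp] at hf
    obtain ⟨g, hg, huniq⟩ := hσ.existsUnique_lift (f ≫ i) hf
    refine ⟨pullback.lift g f hg, pullback.lift_snd _ _ _, fun k hk => ?_⟩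
    refine pullback.hom_ext ?_ ?_
    · rw [pullback.lift_fst]
      refine huniq _ ?_
      change (k ≫ _) ≫ σ = _
      rw [Category.assoc, pullback.condition, reassoc_of% hk]
    · rw [pullback.lift_snd, hk]

section Family

variable {B 𝒳 𝒳' : Scheme.{u}} (π : 𝒳 ⟶ B) {b : B} (hb : IsClosed ({b} : Set B))

include hb in
lemma primePoint_mem_fiber_iff {x : 𝒳} {t : 𝒳.presheaf.stalk x}
    (ht : stalkIdeal (π.fiberι b).ker x = Ideal.span {t}) (p : Ideal (𝒳.presheaf.stalk x))
    [p.IsPrime] : primePoint x p ∈ π ⁻¹' {b} ↔ t ∈ p := by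
  rw [← support_ker_fiberι π hb]
  exact (primePoint_mem_support_iff x p _).trans (by rw [ht, Ideal.span_singleton_le_iff_mem])

include hb in
-- The primes containing `t` are the points of the fiber, so `t` avoids the minimal primes of the
-- radical ideal of `Z`; normal flatness passes to its powers.
lemma mem_stalkIdeal_pow_of_mul_mem {Z : 𝒳.IdealSheafData}
    (hZred : AlgebraicGeometry.IsReduced Z.subscheme)
    (hZ : IsRegularlyImmersed Z ∨ IsDoubleCoverCenter Z)
    (hZb : HasNoComponentIn (Z.support : Set 𝒳) (π ⁻¹' {b})) {x : 𝒳} {t : 𝒳.presheaf.stalk x}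
    (ht : stalkIdeal (π.fiberι b).ker x = Ideal.span {t}) (n : ℕ) (y : 𝒳.presheaf.stalk x)
    (hy : t * y ∈ stalkIdeal Z x ^ n) : y ∈ stalkIdeal Z x ^ n := by
  have h1 : IsNormallyFlat (stalkIdeal Z x) :=
    hZ.elim (fun h => h.isNormallyFlat x) (fun h => h.isNormallyFlat x)
  refine h1.mem_pow (fun y hy => ?_) n y hy
  exact mem_stalkIdeal_of_mul_mem x Z (hb.preimage π.continuous) hZb
    (fun p _ h => (primePoint_mem_fiber_iff π hb ht p).2 h) hy

variable [Flat π] [IsDomain (B.presheaf.stalk b)] [IsDiscreteValuationRing (B.presheaf.stalk b)]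

include hb in
lemma isEffectiveCartier_comap_pullback_fst {Z : 𝒳.IdealSheafData}
    (hZred : AlgebraicGeometry.IsReduced Z.subscheme)
    (hZ : IsRegularlyImmersed Z ∨ IsDoubleCoverCenter Z)
    (hZb : HasNoComponentIn (Z.support : Set 𝒳) (π ⁻¹' {b})) {σ : 𝒳' ⟶ 𝒳} (hσ : IsBlowUp σ Z) :
    IsEffectiveCartier ((Z.comap σ).comap (pullback.fst σ (π.fiberι b))) := by
  have := isClosedImmersion_fiberι π hb
  refine isEffectiveCartier_comap_of_forall_mem _ hσ.isEffectiveCartier fun y f hf v hv => ?_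
  have hy : π (σ (pullback.fst σ (π.fiberι b) y)) = b := by
    have h1 : σ (pullback.fst σ (π.fiberι b) y) = π.fiberι b (pullback.snd σ (π.fiberι b) y) := by
      rw [← Scheme.Hom.comp_apply, pullback.condition, Scheme.Hom.comp_apply]
    rw [h1, apply_fiberι]
  obtain ⟨t, -, ht⟩ := exists_stalkIdeal_ker_fiberι_eq π b hb _ hy
  obtain ⟨a, ha⟩ := hσ.exists_isBlowUpChart (pullback.fst σ (π.fiberι b) y)
  have e : (pullback.fst σ (π.fiberι b)).ker = (π.fiberι b).ker.comap σ :=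
    Scheme.IdealSheafData.ker_fst_of_isClosedImmersion _ _
  rw [e, stalkIdeal_comap, ht, Ideal.map_span, Set.image_singleton] at hv ⊢
  rw [stalkIdeal_comap] at hf
  exact ha.mem_span_of_mul_mem (mem_stalkIdeal_pow_of_mul_mem π hb hZred hZ hZb ht) hf hv

end Family

end FamilyBlowUp

/-! ### Restriction of Cartier divisors to the fiber -/

namespace FamilyBlowUp

variable {X Y : Scheme.{u}}

/-- The pullback of a Cartier divisor to a closed subscheme of a locally Noetherian scheme exists
as soon as it exists at all points. -/
lemma CartierDivisor.exists_isPullbackOf_of_isClosedImmersion [IsLocallyNoetherian X] (i : Y ⟶ X)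
    [IsClosedImmersion i] (D : CartierDivisor X)
    (h : ∀ y : Y, ∃ a b : nonZeroDivisors (X.presheaf.stalk (i y)),
      (i.stalkMap y).hom a ∈ nonZeroDivisors (Y.presheaf.stalk y) ∧
      (i.stalkMap y).hom b ∈ nonZeroDivisors (Y.presheaf.stalk y) ∧
      D.1 (i y) = divGerm a - divGerm b) :
    ∃ D' : CartierDivisor Y, IsPullbackOf i D D' := by
  have hY : IsLocallyNoetherian Y := LocallyOfFiniteType.isLocallyNoetherian i
  refine exists_isPullbackOf i D fun y => ?_
  obtain ⟨a, b, ha, hb, e⟩ := h y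
  obtain ⟨U, hU, s, t, hst⟩ := exists_affineOpen D (i y)
  obtain ⟨hs, ht, e'⟩ := hst _ hU
  obtain ⟨a₁, d, hd, ea⟩ := exists_mul_germ_eq U hU (a : X.presheaf.stalk (i y))
  obtain ⟨b₁, d', hd', eb⟩ := exists_mul_germ_eq U hU (b : X.presheaf.stalk (i y))
  obtain ⟨c, hc⟩ := (divGerm_sub_eq_iff _ _ _ _).1 (e'.symm.trans e)
  -- The identity `s b₁ r = a₁ t r'` holds between sections over `U`, so `(a₁ r') / (b₁ r)` presents
  -- `D` wherever both terms are non-zero-divisors. Its germs at `i y` are `a` and `b` up to units.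
  obtain ⟨r, r', hr, hr', er⟩ := exists_mul_eq_mul_of_germ_mul_unit_eq U hU (s := s * b₁)
    (t := a₁ * t) (c * hd.unit * hd'.unit⁻¹) (by
      rw [map_mul, map_mul, ← ea, ← eb, Units.val_mul, Units.val_mul, IsUnit.unit_spec]
      have h1 : X.presheaf.germ U.1 (i y) hU d' * ((hd'.unit⁻¹ : _ˣ) : X.presheaf.stalk (i y)) = 1 :=
        hd'.mul_val_inv
      simp only at hc
      linear_combination (X.presheaf.germ U.1 (i y) hU d * X.presheaf.germ U.1 (i y) hU d' *
        ((hd'.unit⁻¹ : _ˣ) : X.presheaf.stalk (i y))) * hc + (a * X.presheaf.germ U.1 (i y) hU t *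
          X.presheaf.germ U.1 (i y) hU d) * h1)
  have hua : X.presheaf.germ U.1 (i y) hU (a₁ * r') =
      a * (X.presheaf.germ U.1 (i y) hU d * X.presheaf.germ U.1 (i y) hU r') := by
    rw [map_mul, ← ea, mul_assoc]
  have hub : X.presheaf.germ U.1 (i y) hU (b₁ * r) =
      b * (X.presheaf.germ U.1 (i y) hU d' * X.presheaf.germ U.1 (i y) hU r) := by
    rw [map_mul, ← eb, mul_assoc]
  obtain ⟨k₁, hk₁, hk₁'⟩ := exists_basicOpen_germ_mem_nonZeroDivisors U hU (a₁ * r') (by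
    rw [hua]; exact mul_mem a.2 (hd.mul hr').mem_nonZeroDivisors)
  obtain ⟨k₂, hk₂, hk₂'⟩ := exists_basicOpen_germ_mem_nonZeroDivisors U hU (b₁ * r) (by
    rw [hub]; exact mul_mem b.2 (hd'.mul hr).mem_nonZeroDivisors)
  let V : Y.affineOpens := ⟨i ⁻¹ᵁ U.1, U.2.preimage i⟩
  have key : ∀ (z : Y) (hz : z ∈ V.1) (w : Γ(X, U.1)), Y.presheaf.germ V.1 z hz (i.app U.1 w) =
      (i.stalkMap z).hom (X.presheaf.germ U.1 (i z) hz w) := fun z hz w =>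
    (Scheme.Hom.germ_stalkMap_apply i U.1 z hz w).symm
  obtain ⟨k₃, hk₃, hk₃'⟩ := exists_basicOpen_germ_mem_nonZeroDivisors V hU (i.app U.1 (a₁ * r')) (by
    have h1 := mul_mem ha ((hd.mul hr').map ((i.stalkMap y).hom)).mem_nonZeroDivisors
    rwa [← map_mul, ← hua, ← key y hU] at h1)
  obtain ⟨k₄, hk₄, hk₄'⟩ := exists_basicOpen_germ_mem_nonZeroDivisors V hU (i.app U.1 (b₁ * r)) (by
    have h1 := mul_mem hb ((hd'.mul hr).map ((i.stalkMap y).hom)).mem_nonZeroDivisors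
    rwa [← map_mul, ← hub, ← key y hU] at h1)
  -- Shrinking keeps the new equation regular on `X`; `k₃` and `k₄` do the same for its restriction
  -- to `Y`.
  let U' : X.Opens := U.1 ⊓ (X.basicOpen k₁ ⊓ X.basicOpen k₂)
  have hU'U : U' ≤ U.1 := inf_le_left
  refine ⟨U', X.presheaf.map (homOfLE hU'U).op (a₁ * r'), X.presheaf.map (homOfLE hU'U).op (b₁ * r),
    i ⁻¹ᵁ U' ⊓ (Y.basicOpen k₃ ⊓ Y.basicOpen k₄), inf_le_left, ⟨⟨hU, hk₁, hk₂⟩, hk₃, hk₄⟩,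
    fun z hz => ?_, fun z hz => ⟨?_, ?_⟩⟩
  · rw [TopCat.Presheaf.germ_res_apply, TopCat.Presheaf.germ_res_apply]
    refine ⟨hk₁' z hz.1 hz.2.1, hk₂' z hz.1 hz.2.2, ?_⟩
    obtain ⟨hs, ht, e⟩ := hst z hz.1
    rw [e]
    refine (divGerm_sub_eq_iff _ _ _ _).2 ⟨1, ?_⟩
    simp only [Units.val_one, mul_one, ← map_mul]
    congr 1
    linear_combination er
  · have h1 := hk₃' z hz.1.1 hz.2.1
    rw [key z hz.1.1] at h1
    exact (congrArg (fun w => (i.stalkMap z).hom w ∈ nonZeroDivisors _)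
      (TopCat.Presheaf.germ_res_apply X.presheaf (homOfLE hU'U) (i z) hz.1 (a₁ * r'))).mpr h1
  · have h1 := hk₄' z hz.1.1 hz.2.2
    rw [key z hz.1.1] at h1
    exact (congrArg (fun w => (i.stalkMap z).hom w ∈ nonZeroDivisors _)
      (TopCat.Presheaf.germ_res_apply X.presheaf (homOfLE hU'U) (i z) hz.1 (b₁ * r))).mpr h1

section Family

variable {B 𝒳 : Scheme.{u}} (π : 𝒳 ⟶ B) {b : B} (hb : IsClosed ({b} : Set B))

include hb in
/-- A reduced fiber `t = 0` of a locally Noetherian scheme and a divisor `f / g` without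
component in it: the equation `f / g` can be rewritten with `f` and `g` invertible at the generic
points of the fiber. -/
lemma CartierDivisor.exists_mul_eq_mul_notMem_minimalPrimes [IsLocallyNoetherian 𝒳]
    {D : CartierDivisor 𝒳} (hD : HasNoComponentIn (support D) (π ⁻¹' {b})) {x : 𝒳}
    {t : 𝒳.presheaf.stalk x} (ht : stalkIdeal (π.fiberι b).ker x = Ideal.span {t})
    (hrad : (Ideal.span {t}).IsRadical) {U : 𝒳.affineOpens} (hU : x ∈ U.1) {f g : Γ(𝒳, U.1)}
    (h : IsLocallyDivOf D.1 U.1 f g) :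
    ∃ f' g' : 𝒳.presheaf.stalk x,
      𝒳.presheaf.germ U.1 x hU f * g' = 𝒳.presheaf.germ U.1 x hU g * f' ∧
      ∀ p ∈ (Ideal.span {t}).minimalPrimes, f' ∉ p ∧ g' ∉ p := by
  obtain ⟨hf, hg, -⟩ := h x hU
  refine exists_mul_eq_mul_of_forall_minimalPrimes hg fun p hp => ?_
  have := hp.1.1
  have hη : primePoint x p ∈ U.1 := primePoint_mem x p U.1 hU
  have hsupp : primePoint x p ∉ support D := by
    intro hmem
    refine hD.notMem_of_forall_specializes (isClosed_support D) (hb.preimage π.continuous) hmem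
      (fun ζ hζ hspec => ?_) ((primePoint_mem_fiber_iff π hb ht p).2
        (hp.1.2 (Ideal.mem_span_singleton_self t)))
    obtain ⟨q, _, rfl⟩ := exists_eq_primePoint (hspec.trans (primePoint_specializes x p))
    have hqp := le_of_primePoint_specializes x p q hspec
    rcases hqp.eq_or_lt with rfl | hlt
    · rfl
    -- A prime strictly below `p` contains neither `f` nor `g`, so both are units at its point,
    -- which therefore lies outside the support.
    · refine (hζ ?_).elim
      have hq : primePoint x q ∈ U.1 := primePoint_mem x q U.1 hU
      obtain ⟨hfq, hgq, e⟩ := h _ hq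
      rw [e, divGerm_eq_zero_of_isUnit, divGerm_eq_zero_of_isUnit, sub_zero]
      · exact (isUnit_germ_primePoint_iff x q U.1 hU hq g).2 (notMem_of_lt_minimalPrimes hrad hp hlt hg)
      · exact (isUnit_germ_primePoint_iff x q U.1 hU hq f).2 (notMem_of_lt_minimalPrimes hrad hp hlt hf)
  obtain ⟨hf', hg', e⟩ := h _ hη
  rw [not_not.1 hsupp, eq_comm, sub_eq_zero] at e
  obtain ⟨c, hc⟩ := (divGerm_eq_iff _ _).1 e
  obtain ⟨d, d', hd, hd', e'⟩ := exists_mul_eq_mul_of_germ_mul_unit_eq U hη c hc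
  refine ⟨_, (isUnit_germ_primePoint_iff x p U.1 hU hη d).1 hd, _,
    (isUnit_germ_primePoint_iff x p U.1 hU hη d').1 hd', ?_⟩
  rw [← map_mul, e', map_mul]

variable [Flat π] [IsDomain (B.presheaf.stalk b)] [IsDiscreteValuationRing (B.presheaf.stalk b)]

include hb in
/-- A Cartier divisor without component in a reduced fiber restricts to the fiber. -/
lemma CartierDivisor.exists_isPullbackOf_fiberι [IsLocallyNoetherian 𝒳]
    (hred : AlgebraicGeometry.IsReduced (π.fiber b)) (D : CartierDivisor 𝒳)
    (hD : HasNoComponentIn (support D) (π ⁻¹' {b})) :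
    ∃ D₀ : CartierDivisor (π.fiber b), IsPullbackOf (π.fiberι b) D D₀ := by
  have := isClosedImmersion_fiberι π hb
  refine exists_isPullbackOf_of_isClosedImmersion _ D fun y => ?_
  obtain ⟨t, ht, hker⟩ := exists_stalkIdeal_ker_fiberι_eq π b hb _ (apply_fiberι π b y)
  have hmem : ∀ a, a ∈ Ideal.span {t} ↔ ((π.fiberι b).stalkMap y).hom a = 0 := fun a => by
    rw [← hker, ← ker_stalkMap, RingHom.mem_ker]
  have hrad : (Ideal.span {t}).IsRadical := by
    rintro a ⟨n, hn⟩
    rw [hmem, map_pow] at hn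
    exact (hmem a).2 (eq_zero_of_pow_eq_zero hn)
  have htm : t ∈ IsLocalRing.maximalIdeal (𝒳.presheaf.stalk (π.fiberι b y)) := by
    refine (IsLocalRing.mem_maximalIdeal _).2 fun hu => ?_
    have h1 := hu.map ((π.fiberι b).stalkMap y).hom
    rw [(hmem t).1 (Ideal.mem_span_singleton_self t)] at h1
    exact not_isUnit_zero h1
  obtain ⟨U, hU, f, g, hfg⟩ := exists_affineOpen D (π.fiberι b y)
  obtain ⟨f', g', e, hp⟩ := exists_mul_eq_mul_notMem_minimalPrimes π hb hD hker hrad hU hfg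
  obtain ⟨hf, hg, eD⟩ := hfg _ hU
  have key : ∀ a, (∀ p ∈ (Ideal.span {t}).minimalPrimes, a ∉ p) →
      a ∈ nonZeroDivisors (𝒳.presheaf.stalk (π.fiberι b y)) ∧
      ((π.fiberι b).stalkMap y).hom a ∈ nonZeroDivisors ((π.fiber b).presheaf.stalk y) := by
    intro a ha
    have h1 : ∀ v, a * v ∈ Ideal.span {t} → v ∈ Ideal.span {t} := fun v hv =>
      mem_of_mul_mem_of_forall_notMem_minimalPrimes hrad ha hv
    refine ⟨mem_nonZeroDivisors_of_mul_mem_span htm ht h1, mem_nonZeroDivisors_iff_left.2 ?_⟩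
    intro v hv
    obtain ⟨v, rfl⟩ := (π.fiberι b).stalkMap_surjective y v
    exact (hmem v).1 (h1 v ((hmem _).2 ((map_mul _ _ _).trans hv)))
  obtain ⟨hf₁, hf₂⟩ := key f' fun p h => (hp p h).1
  obtain ⟨hg₁, hg₂⟩ := key g' fun p h => (hp p h).2
  refine ⟨⟨f', hf₁⟩, ⟨g', hg₁⟩, hf₂, hg₂, eD.trans ((divGerm_sub_eq_iff _ _ _ _).2 ⟨1, ?_⟩)⟩
  rw [Units.val_one, mul_one]
  exact e.trans (mul_comm _ _)

end Family

end FamilyBlowUp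

theorem mainTheorem3 {B 𝒳 𝒳' : Scheme.{u}} [IsLocallyNoetherian B] [IsLocallyNoetherian 𝒳]
    (π : 𝒳 ⟶ B) [Flat π]
    (b : B) (hb : IsClosed ({b} : Set B)) [IsDomain (B.presheaf.stalk b)]
    [IsDiscreteValuationRing (B.presheaf.stalk b)]
    (Z : 𝒳.IdealSheafData) (hZred : AlgebraicGeometry.IsReduced Z.subscheme)
    (hZ : IsRegularlyImmersed Z ∨ IsDoubleCoverCenter Z)
    (hZb : HasNoComponentIn (Z.support : Set 𝒳) (π ⁻¹' {b}))
    (σ : 𝒳' ⟶ 𝒳) (hσ : IsBlowUp σ Z) :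
    ∃ hσ₀ : IsBlowUp (pullback.snd σ (π.fiberι b)) (Z.comap (π.fiberι b)),
      (Z.comap σ).comap (pullback.fst σ (π.fiberι b)) =
        (Z.comap (π.fiberι b)).comap (pullback.snd σ (π.fiberι b)) ∧
      CartierDivisor.IsPullbackOf (pullback.fst σ (π.fiberι b))
        hσ.exceptionalDivisor hσ₀.exceptionalDivisor ∧
      (AlgebraicGeometry.IsReduced (π.fiber b) →
        ∀ D : CartierDivisor 𝒳, HasNoComponentIn (CartierDivisor.support D) (π ⁻¹' {b}) → ∀ k : ℤ,
          ∃ (σD : CartierDivisor 𝒳') (D₀ : CartierDivisor (π.fiber b))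
            (σ₀D₀ : CartierDivisor (pullback σ (π.fiberι b))),
            CartierDivisor.IsPullbackOf σ D σD ∧
            CartierDivisor.IsPullbackOf (π.fiberι b) D D₀ ∧
            CartierDivisor.IsPullbackOf (pullback.snd σ (π.fiberι b)) D₀ σ₀D₀ ∧
            CartierDivisor.IsPullbackOf (pullback.fst σ (π.fiberι b))
              (σD - k • hσ.exceptionalDivisor) (σ₀D₀ - k • hσ₀.exceptionalDivisor)) := by
  have e : (Z.comap σ).comap (pullback.fst σ (π.fiberι b)) =
      (Z.comap (π.fiberι b)).comap (pullback.snd σ (π.fiberι b)) := by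
    rw [← Scheme.IdealSheafData.comap_comp, ← Scheme.IdealSheafData.comap_comp, pullback.condition]
  have hE := isEffectiveCartier_comap_pullback_fst π hb hZred hZ hZb hσ
  rw [e] at hE
  have hσ₀ := hσ.pullback_snd (π.fiberι b) hE
  have hexc := hσ.isEffectiveCartier.isPullbackOf (pullback.fst σ (π.fiberι b))
    hσ₀.isEffectiveCartier e
  refine ⟨hσ₀, e, hexc, fun hred D hD k => ?_⟩
  obtain ⟨σD, hσD⟩ := CartierDivisor.exists_isPullbackOf_of_preservesNonZeroDivisors
    hσ.preservesNonZeroDivisors D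
  obtain ⟨D₀, hD₀⟩ := CartierDivisor.exists_isPullbackOf_fiberι π hb hred D hD
  obtain ⟨σ₀D₀, hσ₀D₀⟩ := CartierDivisor.exists_isPullbackOf_of_preservesNonZeroDivisors
    hσ₀.preservesNonZeroDivisors D₀
  refine ⟨σD, D₀, σ₀D₀, hσD, hD₀, hσ₀D₀, ?_⟩
  -- Pulling `D` back through the fiber gives its pullback along the diagonal of the fiber square;
  -- factoring the diagonal through `σ` identifies this with the restriction of `σD`.
  have h := hD₀.comp hσ₀D₀ hσ₀.preservesNonZeroDivisors
  rw [← pullback.condition] at h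
  exact (h.of_comp hσD hσ.preservesNonZeroDivisors).sub (hexc.zsmul k)
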